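/- Let $V$ be a finite-dimensional complex vector space. A projective variety $Z\subset\mathbb{P}V$ (an irreducible Zariski closed subset) is nondegenerate if it lies in no hyperplane. Let $x\in Z$ be a nonsingular point. A $\mathbb{C}^\times$-action on $Z$ given by an algebraic homomorphism $\rho:\mathbb{C}^\times\to GL(V)$ preserving $Z$ is of Euler type at $x$ if $x$ is an isolated fixed point of the action on $Z$ and each $\rho(s)$ acts on $T_xZ$ by scalar multiplication. A nondegenerate projective variety $Z\subset \mathbb{P}V$ is Euler-symmetric if for every $x$ in some nonempty Zariski open subset of $Z$, the point $x$ is nonsingular and there is a $\mathbb{C}^\times$-action on $Z$ of Euler type at $x$. Let $\mathfrak m_x$ be the maximal ideal of the local ring $\mathcal{O}_{Z,x}$ at a nonsingular point $x$, and let $l_0\in V^*$ be a linear form with $l_0(x)\neq 0$. For $k\ge 2$ the $k$-th fundamental form $F^k_x\subset \mathrm{Sym}^k T_x^*Z=\mathfrak m_x^k/\mathfrak m_x^{k+1}$ is the space of classes of the germs $l/l_0$, where $l$ runs over the linear forms in $V^*$ with $l/l_0\in\mathfrak m_x^k$ (it does not depend on $l_0$); moreover $F^0_x=\mathbb{C}$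 and $F^1_x=T^*_xZ$. The systems $\mathbf F_{x_1}=\bigoplus_k F^k_{x_1}$ and $\mathbf F_{x_2}=\bigoplus_k F^k_{x_2}$ of fundamental forms of two varieties $Z_1,Z_2\subset\mathbb{P}V$ of equal dimension at nonsingular points $x_1\in Z_1$, $x_2\in Z_2$ are isomorphic if there is a linear isomorphism $T^*_{x_1}Z_1\to T^*_{x_2}Z_2$ whose induced isomorphism of symmetric algebras maps $\mathbf F_{x_1}$ onto $\mathbf F_{x_2}$. **Proposition.** (1) Let $Z_1,Z_2\subset\mathbb{P}V$ be Euler-symmetric projective varieties of equal dimension, and let $x_1\in Z_1$, $x_2\in Z_2$ be general points; precisely, it is enough that $x_i$ is a nonsingular point of $Z_i$ at which $Z_i$ admits a $\mathbb{C}^\times$-action of Euler type ($i=1,2$). If $\mathbf F_{x_1}$ and $\mathbf F_{x_2}$ are isomorphic, then $g(Z_1)=Z_2$ for some $g\in GL(V)$ acting on $\mathbb{P}V$. (2) Let $Z\subset\mathbb{P}V$ be a nondegenerate projective variety with a $\mathbb{C}^\times$-action of Euler type at a nonsingular point $x\in Z$, given by $\rho$, and let $n=\dim Z$. There are homogeneous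 coordinates $t,z_1,\dots,z_n,u_1,\dots,u_m$ on $\mathbb{P}V$ which are eigenvectors for $\rho$, such that $x=[1:0:\dots:0]$ and the embedded tangent space of $Z$ at $x$ is $\{u_1=\dots=u_m=0\}$. In any such coordinates there are linearly independent homogeneous polynomials $h_1,\dots,h_m$ in $n$ variables, each $h_j$ of some degree $d_j\geq 2$, such that in the affine chart $t\neq0$ the variety $Z$ is defined by the equations $u_j/t=h_j(z_1/t,\dots,z_n/t)$, $1\le j\le m$. -/

import Mathlib

open scoped LinearAlgebra.Projectivization
open Topology Filter

namespace EulerSymm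

noncomputable section

variable {V : Type*} [AddCommGroup V] [Module ℂ V]

/-- The value at `v` of a polynomial in linear forms on `V`. Every polynomial function on `V` is of
this form, and those that are homogeneous of degree `k` come from homogeneous `p` of degree `k`. -/
def polyVal (p : MvPolynomial (Module.Dual ℂ V) ℂ) (v : V) : ℂ :=
  MvPolynomial.eval (fun l : Module.Dual ℂ V => l v) p

/-- The Zariski topology on `ℙ V`, generated by the complements of hypersurfaces. -/
abbrev zariski (V : Type*) [AddCommGroup V] [Module ℂ V] : TopologicalSpace (ℙ ℂ V) :=
  TopologicalSpace.generateFrom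
    {U | ∃ (k : ℕ) (g : MvPolynomial (Module.Dual ℂ V) ℂ), g.IsHomogeneous k ∧
      U = {y | polyVal g y.rep ≠ 0}}

/-- Projective varieties: irreducible Zariski closed subsets of `ℙ V`. -/
def IsProjectiveVariety (Z : Set (ℙ ℂ V)) : Prop :=
  IsClosed[zariski V] Z ∧ @IsIrreducible _ (zariski V) Z

/-- `Z` is not contained in a hyperplane. -/
def IsNondegenerate (Z : Set (ℙ ℂ V)) : Prop :=
  ∀ l : Module.Dual ℂ V, (∀ y ∈ Z, l y.rep = 0) → l = 0

/-- The dimension of `Z` as a topological space with the Zariski topology. -/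
def zariskiDim (Z : Set (ℙ ℂ V)) : WithBot ℕ∞ :=
  @topologicalKrullDim Z ((zariski V).induced Subtype.val)

/-! ### The local ring of a variety at a point -/

/-- The filter of Zariski neighbourhoods of `x` in `Z`. -/
def nhdsOn (Z : Set (ℙ ℂ V)) (x : ℙ ℂ V) : Filter (ℙ ℂ V) := @nhdsWithin _ (zariski V) x Z

/-- The ring of germs at `x` of arbitrary functions on `Z` is a complex algebra. -/
instance germAlgebra (L : Filter (ℙ ℂ V)) : Algebra ℂ (Germ L ℂ) :=
  Algebra.ofModule
    (fun r a b => by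
      induction a using Germ.inductionOn with | _ f =>
      induction b using Germ.inductionOn with | _ g =>
      exact congrArg (fun t : ℙ ℂ V → ℂ => (t : Germ L ℂ)) (smul_mul_assoc r f g))
    (fun r a b => by
      induction a using Germ.inductionOn with | _ f =>
      induction b using Germ.inductionOn with | _ g =>
      exact congrArg (fun t : ℙ ℂ V → ℂ => (t : Germ L ℂ)) (mul_smul_comm r f g))

/-- The function `f / g` on `ℙ V`; for homogeneous `f`, `g` of the same degree it does not depend
on the chosen representatives. -/
def frac (f g : MvPolynomial (Module.Dual ℂ V) ℂ) : ℙ ℂ V → ℂ :=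
  fun y => polyVal f y.rep / polyVal g y.rep

/-- `φ` is the germ of a quotient `f / g` of homogeneous polynomials of the same degree with
`g x ≠ 0`. -/
def IsFracGerm (Z : Set (ℙ ℂ V)) (x : ℙ ℂ V) (f g : MvPolynomial (Module.Dual ℂ V) ℂ)
    (φ : Germ (nhdsOn Z x) ℂ) : Prop :=
  (∃ k : ℕ, f.IsHomogeneous k ∧ g.IsHomogeneous k) ∧ polyVal g x.rep ≠ 0 ∧
    φ = (frac f g : Germ (nhdsOn Z x) ℂ)

theorem nhdsOn_ne (Z : Set (ℙ ℂ V)) (x : ℙ ℂ V) {k : ℕ} {g : MvPolynomial (Module.Dual ℂ V) ℂ}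
    (hg : g.IsHomogeneous k) (hx : polyVal g x.rep ≠ 0) :
    ∀ᶠ y in nhdsOn Z x, polyVal g y.rep ≠ 0 := by
  let _ := zariski V
  have ho : IsOpen {y : ℙ ℂ V | polyVal g y.rep ≠ 0} :=
    TopologicalSpace.isOpen_generateFrom_of_mem ⟨k, g, hg, rfl⟩
  exact mem_nhdsWithin_of_mem_nhds (ho.mem_nhds hx)

theorem IsFracGerm.mul {Z : Set (ℙ ℂ V)} {x : ℙ ℂ V} {f g f' g' : MvPolynomial (Module.Dual ℂ V) ℂ}
    {φ ψ : Germ (nhdsOn Z x) ℂ} (h : IsFracGerm Z x f g φ) (h' : IsFracGerm Z x f' g' ψ) :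
    IsFracGerm Z x (f * f') (g * g') (φ * ψ) := by
  obtain ⟨⟨k, hf, hg⟩, hx, rfl⟩ := h
  obtain ⟨⟨k', hf', hg'⟩, hx', rfl⟩ := h'
  refine ⟨⟨k + k', hf.mul hf', hg.mul hg'⟩, ?_, ?_⟩
  · simpa [polyVal] using ⟨hx, hx'⟩
  · rw [← Germ.coe_mul]
    congr 1
    funext y
    simp [frac, polyVal, div_mul_div_comm]

theorem IsFracGerm.add {Z : Set (ℙ ℂ V)} {x : ℙ ℂ V} {f g f' g' : MvPolynomial (Module.Dual ℂ V) ℂ}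
    {φ ψ : Germ (nhdsOn Z x) ℂ} (h : IsFracGerm Z x f g φ) (h' : IsFracGerm Z x f' g' ψ) :
    IsFracGerm Z x (f * g' + g * f') (g * g') (φ + ψ) := by
  obtain ⟨⟨k, hf, hg⟩, hx, rfl⟩ := h
  obtain ⟨⟨k', hf', hg'⟩, hx', rfl⟩ := h'
  refine ⟨⟨k + k', (hf.mul hg').add (hg.mul hf'), hg.mul hg'⟩, ?_, ?_⟩
  · simpa [polyVal] using ⟨hx, hx'⟩
  · rw [← Germ.coe_add]
    refine Germ.coe_eq.2 ?_
    filter_upwards [nhdsOn_ne Z x hg hx, nhdsOn_ne Z x hg' hx'] with y hy hy'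
    simp only [polyVal] at hy hy'
    simp [frac, polyVal, div_add_div _ _ hy hy']

theorem IsFracGerm.const (Z : Set (ℙ ℂ V)) (x : ℙ ℂ V) (r : ℂ) :
    IsFracGerm Z x (MvPolynomial.C r) 1 (algebraMap ℂ (Germ (nhdsOn Z x) ℂ) r) := by
  refine ⟨⟨0, MvPolynomial.isHomogeneous_C _ _, MvPolynomial.isHomogeneous_one _ _⟩, ?_, ?_⟩
  · simp [polyVal]
  · rw [Algebra.algebraMap_eq_smul_one]
    refine congrArg (fun t : ℙ ℂ V → ℂ => (t : Germ (nhdsOn Z x) ℂ)) ?_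
    funext y
    simp [frac, polyVal]

/-- The local ring of `Z` at `x`: germs at `x` of regular functions on `Z`. -/
def localRing (Z : Set (ℙ ℂ V)) (x : ℙ ℂ V) : Subalgebra ℂ (Germ (nhdsOn Z x) ℂ) where
  carrier := {φ | ∃ f g, IsFracGerm Z x f g φ}
  mul_mem' := fun ⟨_, _, h⟩ ⟨_, _, h'⟩ => ⟨_, _, h.mul h'⟩
  add_mem' := fun ⟨_, _, h⟩ ⟨_, _, h'⟩ => ⟨_, _, h.add h'⟩
  algebraMap_mem' := fun r => ⟨_, _, IsFracGerm.const Z x r⟩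

/-- The maximal ideal of the local ring: the germs of regular functions that vanish at `x`. -/
def maxIdeal (Z : Set (ℙ ℂ V)) (x : ℙ ℂ V) : Ideal (localRing Z x) where
  carrier := {φ | ∃ f g, IsFracGerm Z x f g φ.1 ∧ polyVal f x.rep = 0}
  add_mem' := by
    rintro a b ⟨f, g, h, h0⟩ ⟨f', g', h', h0'⟩
    refine ⟨_, _, h.add h', ?_⟩
    simp only [polyVal] at h0 h0'
    simp [polyVal, h0, h0']
  zero_mem' := by
    refine ⟨_, _, by simpa using IsFracGerm.const Z x 0, ?_⟩
    simp [polyVal]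
  smul_mem' := by
    rintro ⟨c, f', g', h'⟩ b ⟨f, g, h, h0⟩
    refine ⟨_, _, h'.mul h, ?_⟩
    simp only [polyVal] at h0
    simp [polyVal, h0]

/-- The cotangent space of `Z` at `x`. -/
abbrev Cotangent (Z : Set (ℙ ℂ V)) (x : ℙ ℂ V) : Type _ := (maxIdeal Z x).Cotangent

/-- `x` is a nonsingular point of `Z`. -/
def IsNonsingularAt (Z : Set (ℙ ℂ V)) (x : ℙ ℂ V) : Prop :=
  x ∈ Z ∧ IsRegularLocalRing (localRing Z x)

/-! ### Actions of Euler type -/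

/-- `ρ` is a homomorphism of algebraic groups: its matrix coefficients are Laurent polynomials. -/
def IsAlgebraicHom (ρ : ℂˣ →* LinearMap.GeneralLinearGroup ℂ V) : Prop :=
  ∀ (l : Module.Dual ℂ V) (v : V), ∃ p : LaurentPolynomial ℂ,
    ∀ s : ℂˣ, l ((ρ s : V →ₗ[ℂ] V) v) = LaurentPolynomial.eval₂ (RingHom.id ℂ) s p

/-- The map `g`, which is supposed to preserve `Z` and to fix `x`, acts on the (co)tangent space of
`Z` at `x` as multiplication by `c`: it sends the class of the germ of a regular function `F`
vanishing at `x` to the class of the germ of `F ∘ g`. -/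
def ActsAsScalar (Z : Set (ℙ ℂ V)) (x : ℙ ℂ V) (g : LinearMap.GeneralLinearGroup ℂ V) (c : ℂ) :
    Prop :=
  ∀ (F : ℙ ℂ V → ℂ) (φ ψ : localRing Z x),
    (φ : Germ (nhdsOn Z x) ℂ) = (F : Germ (nhdsOn Z x) ℂ) →
    (ψ : Germ (nhdsOn Z x) ℂ) = ((fun y => F (g • y) : ℙ ℂ V → ℂ) : Germ (nhdsOn Z x) ℂ) →
    φ ∈ maxIdeal Z x → ψ - c • φ ∈ maxIdeal Z x ^ 2

/-- `ρ` induces an action of the multiplicative group on `Z` that is of Euler type at the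
nonsingular point `x`. -/
structure IsEulerType (Z : Set (ℙ ℂ V)) (x : ℙ ℂ V)
    (ρ : ℂˣ →* LinearMap.GeneralLinearGroup ℂ V) : Prop where
  nonsingular : IsNonsingularAt Z x
  algebraic : IsAlgebraicHom ρ
  preserves : ∀ s : ℂˣ, ∀ y ∈ Z, ρ s • y ∈ Z
  fixed : ∀ s : ℂˣ, ρ s • x = x
  isolated : ∃ U : Set (ℙ ℂ V), IsOpen[zariski V] U ∧ x ∈ U ∧
    ∀ y ∈ Z ∩ U, (∀ s : ℂˣ, ρ s • y = y) → y = x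
  scalar : ∀ s : ℂˣ, ∃ c : ℂ, ActsAsScalar Z x (ρ s) c

/-- `Z` admits an action of Euler type at `x`. -/
def HasEulerAction (Z : Set (ℙ ℂ V)) (x : ℙ ℂ V) : Prop :=
  ∃ ρ : ℂˣ →* LinearMap.GeneralLinearGroup ℂ V, IsEulerType Z x ρ

/-- Euler-symmetric projective varieties: nondegenerate projective varieties with an action of
Euler type at each point of a nonempty Zariski open subset. -/
structure IsEulerSymmetric (Z : Set (ℙ ℂ V)) : Prop where
  variety : IsProjectiveVariety Z
  nondegenerate : IsNondegenerate Z
  general : ∃ U : Set (ℙ ℂ V), IsOpen[zariski V] U ∧ (Z ∩ U).Nonempty ∧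
    ∀ x ∈ Z ∩ U, HasEulerAction Z x

/-! ### Fundamental forms -/

theorem polyVal_X (l : Module.Dual ℂ V) (v : V) : polyVal (MvPolynomial.X l) v = l v := by
  simp [polyVal]

/-- The linear map sending a linear form `l`, viewed as a section of the hyperplane bundle, to the
germ of `l / l₀` at `x`, for a linear form `l₀` that does not vanish at `x`. -/
def linearGerm (Z : Set (ℙ ℂ V)) (x : ℙ ℂ V) (l₀ : Module.Dual ℂ V) (h₀ : l₀ x.rep ≠ 0) :
    Module.Dual ℂ V →ₗ[ℂ] localRing Z x where
  toFun l := ⟨((fun y => l y.rep / l₀ y.rep : ℙ ℂ V → ℂ) : Germ (nhdsOn Z x) ℂ),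
    MvPolynomial.X l, MvPolynomial.X l₀,
    ⟨1, MvPolynomial.isHomogeneous_X _ _, MvPolynomial.isHomogeneous_X _ _⟩,
    by rwa [polyVal_X], by
      congr 1
      funext y
      simp only [frac, polyVal_X]⟩
  map_add' l l' := by
    refine Subtype.ext (congrArg (fun t : ℙ ℂ V → ℂ => (t : Germ (nhdsOn Z x) ℂ)) ?_)
    funext y
    simp [add_div]
  map_smul' r l := by
    refine Subtype.ext (congrArg (fun t : ℙ ℂ V → ℂ => (t : Germ (nhdsOn Z x) ℂ)) ?_)
    funext y
    simp [mul_div_assoc]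

theorem exists_linearForm (x : ℙ ℂ V) : ∃ l₀ : Module.Dual ℂ V, l₀ x.rep ≠ 0 := by
  by_contra! h
  exact x.rep_nonzero ((Module.forall_dual_apply_eq_zero_iff ℂ x.rep).1 h)

/-- A linear form that does not vanish at `x`, that is, a trivialization of the hyperplane bundle
near `x`. -/
def trivForm (x : ℙ ℂ V) : Module.Dual ℂ V := (exists_linearForm x).choose

theorem trivForm_ne (x : ℙ ℂ V) : trivForm x x.rep ≠ 0 := (exists_linearForm x).choose_spec

/-- Evaluation of polynomials with formal variables in the maximal ideal in the local ring. -/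
def evalLocal (Z : Set (ℙ ℂ V)) (x : ℙ ℂ V) :
    MvPolynomial (maxIdeal Z x) ℂ →ₐ[ℂ] localRing Z x :=
  MvPolynomial.aeval (fun a => (a : localRing Z x))

/-- Evaluation of polynomials with formal variables in the maximal ideal in the symmetric algebra of
the cotangent space. -/
def evalSymm (Z : Set (ℙ ℂ V)) (x : ℙ ℂ V) :
    MvPolynomial (maxIdeal Z x) ℂ →ₐ[ℂ] SymmetricAlgebra ℂ (Cotangent Z x) :=
  MvPolynomial.aeval (fun a => SymmetricAlgebra.ι ℂ (Cotangent Z x) ((maxIdeal Z x).toCotangent a))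

/-- The subspace of `Sym^k` of the cotangent space formed by the leading terms of degree `k` of
those linear forms on `V` whose `(k-1)`-jet at `x` along `Z` vanishes. The `(k-1)`-jet of a linear
form `l` vanishes if `l / l₀` lies in the `k`-th power of the maximal ideal `𝔪`; then `l / l₀` is
congruent modulo `𝔪 ^ (k + 1)` to the value in the local ring of a homogeneous polynomial `P` of
degree `k` in elements of `𝔪`, and the value of `P` in `Sym^k (𝔪 / 𝔪²)` is the leading term; this is
the identification of `𝔪 ^ k / 𝔪 ^ (k + 1)` with `Sym^k (𝔪 / 𝔪²)` at a nonsingular point.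
Changing `l₀` rescales leading terms, so the subspace does not depend on it. -/
def leadingForms (Z : Set (ℙ ℂ V)) (x : ℙ ℂ V) (k : ℕ) :
    Submodule ℂ (SymmetricAlgebra ℂ (Cotangent Z x)) :=
  Submodule.span ℂ {q | ∃ (P : MvPolynomial (maxIdeal Z x) ℂ) (l : Module.Dual ℂ V),
    P.IsHomogeneous k ∧
    linearGerm Z x (trivForm x) (trivForm_ne x) l - evalLocal Z x P ∈ maxIdeal Z x ^ (k + 1) ∧
    q = evalSymm Z x P}

/-- The system of fundamental forms of `Z` at `x`: all of `Sym^0` and `Sym^1` in degrees 0 and 1,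
and the `k`-th fundamental form in degree `k ≥ 2`. -/
def fundamentalForms (Z : Set (ℙ ℂ V)) (x : ℙ ℂ V) :
    ℕ → Submodule ℂ (SymmetricAlgebra ℂ (Cotangent Z x))
  | 0 => 1
  | 1 => LinearMap.range (SymmetricAlgebra.ι ℂ (Cotangent Z x))
  | (k + 2) => leadingForms Z x (k + 2)

/-- The map induced on symmetric algebras by a linear map. -/
def symMap {M N : Type*} [AddCommGroup M] [Module ℂ M] [AddCommGroup N] [Module ℂ N]
    (φ : M →ₗ[ℂ] N) : SymmetricAlgebra ℂ M →ₐ[ℂ] SymmetricAlgebra ℂ N :=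
  SymmetricAlgebra.lift (SymmetricAlgebra.ι ℂ N ∘ₗ φ)

/-- The systems of fundamental forms of `Z₁` at `x₁` and of `Z₂` at `x₂` are isomorphic. -/
def FundamentalFormsIso (Z₁ : Set (ℙ ℂ V)) (x₁ : ℙ ℂ V) (Z₂ : Set (ℙ ℂ V)) (x₂ : ℙ ℂ V) : Prop :=
  ∃ φ : Cotangent Z₁ x₁ ≃ₗ[ℂ] Cotangent Z₂ x₂, ∀ k : ℕ,
    (fundamentalForms Z₁ x₁ k).map (symMap φ.toLinearMap).toLinearMap = fundamentalForms Z₂ x₂ k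

/-- Some projective transformation of `ℙ V` maps `Z₁` onto `Z₂`. -/
def ProjectivelyEquivalent (Z₁ Z₂ : Set (ℙ ℂ V)) : Prop :=
  ∃ g : LinearMap.GeneralLinearGroup ℂ V, (fun y => g • y) '' Z₁ = Z₂

/-! ### Adapted coordinates -/

/-- The index set of homogeneous coordinates `t, z_1, …, z_n, u_1, …, u_m` on `ℙ V`: `none` stands
for `t`, `inl i` for `z_i` and `inr j` for `u_j`. -/
abbrev CoordIdx (n m : ℕ) : Type := Option (Fin n ⊕ Fin m)

/-- Homogeneous coordinates `t, z_1, …, z_n, u_1, …, u_m` on `ℙ V`, `n` the dimension of `Z`, such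
that all of them are eigenvectors of `ρ`, the point `x` is the origin of the affine chart `t ≠ 0`,
and the embedded tangent space of `Z` at `x` is defined by `u_1 = … = u_m = 0`. -/
structure IsAdapted (Z : Set (ℙ ℂ V)) (x : ℙ ℂ V) (ρ : ℂˣ →* LinearMap.GeneralLinearGroup ℂ V)
    {n m : ℕ} (b : Module.Basis (CoordIdx n m) ℂ (Module.Dual ℂ V)) : Prop where
  eigen : ∀ i, ∃ w : ℤ, ∀ (s : ℂˣ) (v : V), b i ((ρ s : V →ₗ[ℂ] V) v) = (s : ℂ) ^ w * b i v
  chart : b none x.rep ≠ 0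
  origin : ∀ i, b (some i) x.rep = 0
  finrank_eq : Module.finrank ℂ (Cotangent Z x) = n
  tangent : ∀ j, linearGerm Z x (b none) chart (b (some (Sum.inr j))) ∈ maxIdeal Z x ^ 2

/-- In the chart `t ≠ 0`, `Z` is defined by `u_j / t = h_j (z_1 / t, …, z_n / t)` for linearly
independent homogeneous polynomials `h_j` of degrees at least 2. -/
def IsHomogeneousGraph (Z : Set (ℙ ℂ V)) {n m : ℕ}
    (b : Module.Basis (CoordIdx n m) ℂ (Module.Dual ℂ V)) : Prop :=
  ∃ (d : Fin m → ℕ) (h : Fin m → MvPolynomial (Fin n) ℂ),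
    (∀ j, 2 ≤ d j ∧ (h j).IsHomogeneous (d j)) ∧ LinearIndependent ℂ h ∧
    ∀ y : ℙ ℂ V, b none y.rep ≠ 0 →
      (y ∈ Z ↔ ∀ j, b (some (Sum.inr j)) y.rep / b none y.rep =
        MvPolynomial.eval (fun i => b (some (Sum.inl i)) y.rep / b none y.rep) (h j))

end

end EulerSymm

open scoped LinearAlgebra.Projectivization
open Topology Filter

namespace EulerSymm

noncomputable section

variable {V : Type*} [AddCommGroup V] [Module ℂ V]

/-! ### Polynomial functions on projective space -/

/-! Everything takes place in the local ring of `Z` at `x`, with maximal ideal `𝔪`, under the single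
automorphism `S` induced by `ρ(2)`; since `2` is not a root of unity, it already separates all
weights.

In adapted coordinates the germs `z_i / t` span `𝔪 / 𝔪²`, and the Euler condition gives them a
common eigenvalue `q` under `S`. If `n > 0` and `q` were `1`, then `ρ` would act by scalars and `x`
would not be an isolated fixed point (`IsAdapted.exists_scales`). Hence `S` acts on `𝔪^k / 𝔪^(k+1)`
as `q^k`, with distinct values for distinct `k`. The germ `u_j / t` is an eigenvector in `𝔪²`. If
its eigenvalue is no `q^d` with `d ≥ 2`, it lies in every power of `𝔪` and vanishes by Krull's
intersection theorem. If it is `q^d`, the same argument applied to the remainder shows that it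
equals a homogeneous polynomial of degree `d` in the `z_i / t` (`Scales.eq_zero`,
`Scales.eq_aeval`).

So every germ is a quotient of polynomials in the `z_i / t`. A relation among these would make the
dimension of the local ring smaller than `n`, against regularity (`Spans.aeval_injective`). A
homogeneous polynomial that vanishes on `Z` therefore vanishes identically on the graph of the
`h_j`, and `Z` is that graph in the chart. Nondegeneracy makes the `h_j` linearly independent.

For projective equivalence, the graph is described without coordinates. Restricting linear forms to
the graph embeds `V^*` into `Sym (𝔪 / 𝔪²)`, with `t ↦ 1` and image exactly the system of fundamental
forms (`range_symEquiv_comp_graphMap`). The points of `Z` in the chart are those at which `l ↦ l /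
t` comes from an algebra homomorphism `Sym (𝔪 / 𝔪²) → ℂ`. An isomorphism of the systems thus induces
an automorphism of `V^*`, whose inverse transpose matches the two charts; irreducibility extends
this to all of `Z₁` and `Z₂`. -/

theorem polyVal_smul {f : MvPolynomial (Module.Dual ℂ V) ℂ} {k : ℕ} (hf : f.IsHomogeneous k)
    (c : ℂ) (v : V) : polyVal f (c • v) = c ^ k * polyVal f v := by
  unfold polyVal
  rw [MvPolynomial.eval_eq, MvPolynomial.eval_eq, Finset.mul_sum]
  refine Finset.sum_congr rfl fun d hd => ?_
  have hk : ∑ i ∈ d.support, d i = k := by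
    have := hf (MvPolynomial.mem_support_iff.1 hd)
    rw [← this, Finsupp.weight_apply]
    simp [Finsupp.sum]
  simp only [map_smul, smul_eq_mul, mul_pow, Finset.prod_mul_distrib, Finset.prod_pow_eq_pow_sum,
    hk]
  ring

theorem smul_rep (g : LinearMap.GeneralLinearGroup ℂ V) (y : ℙ ℂ V) :
    ∃ a : ℂˣ, (g • y).rep = (a : ℂ) • (g : V →ₗ[ℂ] V) y.rep := by
  have h : g • y = Projectivization.mk ℂ (g • y.rep)
      ((smul_ne_zero_iff_ne g).mpr y.rep_nonzero) := by
    conv_lhs => rw [← y.mk_rep]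
    rfl
  obtain ⟨a, ha⟩ := Projectivization.exists_smul_eq_mk_rep ℂ (g • y.rep)
    ((smul_ne_zero_iff_ne g).mpr y.rep_nonzero)
  exact ⟨a, by rw [h, ← ha]; rfl⟩

theorem polyVal_rename (f : MvPolynomial (Module.Dual ℂ V) ℂ) (g : V →ₗ[ℂ] V) (v : V) :
    polyVal (MvPolynomial.rename (fun l : Module.Dual ℂ V => l ∘ₗ g) f) v = polyVal f (g v) := by
  simp only [polyVal, MvPolynomial.eval_rename]
  rfl

theorem polyVal_smul_rep_eq_zero {f : MvPolynomial (Module.Dual ℂ V) ℂ} {k : ℕ}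
    (hf : f.IsHomogeneous k) (g : LinearMap.GeneralLinearGroup ℂ V) (y : ℙ ℂ V) :
    polyVal f (g • y).rep = 0 ↔
      polyVal (MvPolynomial.rename (fun l : Module.Dual ℂ V => l ∘ₗ (g : V →ₗ[ℂ] V)) f) y.rep
        = 0 := by
  obtain ⟨a, ha⟩ := smul_rep g y
  rw [ha, polyVal_smul hf, polyVal_rename]
  simp

theorem isOpen_polyVal_ne {f : MvPolynomial (Module.Dual ℂ V) ℂ} {k : ℕ}
    (hf : f.IsHomogeneous k) : IsOpen[zariski V] {y | polyVal f y.rep ≠ 0} :=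
  TopologicalSpace.isOpen_generateFrom_of_mem ⟨k, f, hf, rfl⟩

theorem isOpen_form_ne (l : Module.Dual ℂ V) : IsOpen[zariski V] {y | l y.rep ≠ 0} := by
  simpa only [polyVal_X] using isOpen_polyVal_ne (MvPolynomial.isHomogeneous_X ℂ l)

theorem continuous_smul_zariski (g : LinearMap.GeneralLinearGroup ℂ V) :
    @Continuous _ _ (zariski V) (zariski V) (fun y : ℙ ℂ V => g • y) := by
  let _ := zariski V
  refine continuous_generateFrom_iff.2 ?_
  rintro _ ⟨k, f, hf, rfl⟩
  have : (fun y : ℙ ℂ V => g • y) ⁻¹' {y | polyVal f y.rep ≠ 0} =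
      {y | polyVal (MvPolynomial.rename (fun l : Module.Dual ℂ V => l ∘ₗ (g : V →ₗ[ℂ] V)) f) y.rep
        ≠ 0} := by
    ext y
    exact not_congr (polyVal_smul_rep_eq_zero hf g y)
  rw [this]
  exact isOpen_polyVal_ne hf.rename_isHomogeneous

/-- A Zariski closed set contains each point at which all homogeneous polynomials vanishing on the
set vanish. -/
theorem mem_of_isClosed {Z : Set (ℙ ℂ V)} (hZ : IsClosed[zariski V] Z) {y : ℙ ℂ V}
    (h : ∀ (k : ℕ) (f : MvPolynomial (Module.Dual ℂ V) ℂ), f.IsHomogeneous k →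
      (∀ w ∈ Z, polyVal f w.rep = 0) → polyVal f y.rep = 0) : y ∈ Z := by
  let _ := zariski V
  by_contra hy
  -- The generating sets form a basis: products of polynomials give intersections, and the constant
  -- `1` gives the whole space.
  have hb : TopologicalSpace.IsTopologicalBasis
      {U : Set (ℙ ℂ V) | ∃ (k : ℕ) (g : MvPolynomial (Module.Dual ℂ V) ℂ), g.IsHomogeneous k ∧
        U = {y | polyVal g y.rep ≠ 0}} := by
    refine ⟨?_, ?_, rfl⟩
    · rintro _ ⟨k, f, hf, rfl⟩ _ ⟨k', f', hf', rfl⟩ w hw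
      refine ⟨_, ⟨k + k', f * f', hf.mul hf', rfl⟩, ?_, ?_⟩
      · simpa [polyVal] using hw
      · intro w' hw'
        simpa [polyVal] using hw'
    · refine Set.eq_univ_of_forall fun w => ⟨_, ⟨0, 1, MvPolynomial.isHomogeneous_one _ _, rfl⟩, ?_⟩
      simp [polyVal]
  obtain ⟨_, ⟨k, f, hf, rfl⟩, hyf, hsub⟩ := hb.exists_subset_of_mem_open (show y ∈ Zᶜ from hy)
    hZ.isOpen_compl
  exact hyf (h k f hf fun w hw => by
    by_contra hne
    exact hsub hne hw)

/-! ### The value of a germ at the point -/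

section Value

variable {Z : Set (ℙ ℂ V)} {x : ℙ ℂ V}

theorem eq_of_eventually (hx : x ∈ Z) {p : ℙ ℂ V → Prop} (h : ∀ᶠ y in nhdsOn Z x, p y) : p x := by
  let _ := zariski V
  exact h.self_of_nhdsWithin hx

/-- The value of germs at `x`. -/
def germValue (hx : x ∈ Z) : Germ (nhdsOn Z x) ℂ →+* ℂ where
  toFun φ := φ.liftOn (fun f => f x) fun _ _ h => eq_of_eventually hx h
  map_one' := rfl
  map_zero' := rfl
  map_mul' a b := by
    induction a using Germ.inductionOn with | _ f =>
    induction b using Germ.inductionOn with | _ g => rfl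
  map_add' a b := by
    induction a using Germ.inductionOn with | _ f =>
    induction b using Germ.inductionOn with | _ g => rfl

/-- The value at `x` of germs of regular functions. -/
def evalAt (hx : x ∈ Z) : localRing Z x →ₐ[ℂ] ℂ where
  toRingHom := (germValue hx).comp (localRing Z x).val.toRingHom
  commutes' r := by
    change germValue hx (algebraMap ℂ (Germ (nhdsOn Z x) ℂ) r) = r
    rw [Algebra.algebraMap_eq_smul_one]
    change r * 1 = r
    simp

theorem evalAt_apply (hx : x ∈ Z) (φ : localRing Z x) {F : ℙ ℂ V → ℂ}
    (h : (φ : Germ (nhdsOn Z x) ℂ) = (F : Germ (nhdsOn Z x) ℂ)) : evalAt hx φ = F x := by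
  change germValue hx (φ : Germ (nhdsOn Z x) ℂ) = _
  rw [h]
  rfl

/-- Since `x ∈ Z`, germs have a well-defined value at `x`, so vanishing of the numerator does not
depend on the fraction chosen. -/
theorem mem_maxIdeal (hx : x ∈ Z) {φ : localRing Z x} : φ ∈ maxIdeal Z x ↔ evalAt hx φ = 0 := by
  constructor
  · rintro ⟨f, g, ⟨_, _, h⟩, h0⟩
    rw [evalAt_apply hx φ h, frac, h0, zero_div]
  · intro h
    obtain ⟨f, g, hfg⟩ := φ.2
    refine ⟨f, g, hfg, ?_⟩
    rw [evalAt_apply hx φ hfg.2.2, frac, div_eq_zero_iff] at h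
    exact h.resolve_right hfg.2.1

theorem maxIdeal_isMaximal (hx : x ∈ Z) : (maxIdeal Z x).IsMaximal := by
  have h : maxIdeal Z x = RingHom.ker (evalAt hx).toRingHom := by
    ext φ
    exact mem_maxIdeal hx
  rw [h]
  exact RingHom.ker_isMaximal_of_surjective _ fun c => ⟨algebraMap ℂ _ c, (evalAt hx).commutes c⟩

theorem maxIdeal_eq (hx : x ∈ Z) [IsLocalRing (localRing Z x)] :
    maxIdeal Z x = IsLocalRing.maximalIdeal (localRing Z x) :=
  IsLocalRing.eq_maximalIdeal (maxIdeal_isMaximal hx)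

theorem isUnit_of_evalAt_ne (hx : x ∈ Z) [IsLocalRing (localRing Z x)] {φ : localRing Z x}
    (h : evalAt hx φ ≠ 0) : IsUnit φ := by
  by_contra hn
  have := (IsLocalRing.mem_maximalIdeal φ).2 hn
  rw [← maxIdeal_eq hx, mem_maxIdeal hx] at this
  exact h this

theorem sub_algebraMap_mem_maxIdeal (hx : x ∈ Z) (φ : localRing Z x) :
    φ - algebraMap ℂ _ (evalAt hx φ) ∈ maxIdeal Z x := by
  rw [mem_maxIdeal hx]
  simp

/-- Krull's intersection theorem. -/
theorem eq_zero_of_forall_mem_pow (h : IsNonsingularAt Z x) {φ : localRing Z x} (k₀ : ℕ)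
    (hφ : ∀ k ≥ k₀, φ ∈ maxIdeal Z x ^ k) : φ = 0 := by
  have := h.2
  have hI : ⨅ k : ℕ, maxIdeal Z x ^ k = ⊥ :=
    Ideal.iInf_pow_eq_bot_of_isLocalRing _ (maxIdeal_isMaximal h.1).ne_top
  rw [← Ideal.mem_bot, ← hI, Ideal.mem_iInf]
  intro k
  rcases le_total k₀ k with hk | hk
  · exact hφ k hk
  · exact Ideal.pow_le_pow_right hk (hφ k₀ le_rfl)

end Value

/-! ### Vanishing near a point -/

section Vanishing

variable {Z : Set (ℙ ℂ V)} {x : ℙ ℂ V}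

/-- By irreducibility, two nonempty open subsets of `Z` meet. -/
theorem vanishes_of_eventually (hZ : IsProjectiveVariety Z) (hx : x ∈ Z)
    {f : MvPolynomial (Module.Dual ℂ V) ℂ} {k : ℕ} (hf : f.IsHomogeneous k)
    (h : ∀ᶠ y in nhdsOn Z x, polyVal f y.rep = 0) : ∀ y ∈ Z, polyVal f y.rep = 0 := by
  let _ := zariski V
  intro y hy
  by_contra hne
  obtain ⟨U, hU, hxU, hsub⟩ := mem_nhdsWithin.1 h
  obtain ⟨w, hwZ, hw, hwU⟩ := hZ.2.isPreirreducible _ U (isOpen_polyVal_ne hf) hU ⟨y, hy, hne⟩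
    ⟨x, hx, hxU⟩
  exact hw (hsub ⟨hwU, hwZ⟩)

theorem form_vanishes_of_eventually (hZ : IsProjectiveVariety Z) (hx : x ∈ Z)
    (l : Module.Dual ℂ V) (h : ∀ᶠ y in nhdsOn Z x, l y.rep = 0) : ∀ y ∈ Z, l y.rep = 0 := by
  simpa only [polyVal_X] using vanishes_of_eventually hZ hx (MvPolynomial.isHomogeneous_X ℂ l)
    (by simpa only [polyVal_X] using h)

theorem eventually_mem (Z : Set (ℙ ℂ V)) (x : ℙ ℂ V) : ∀ᶠ y in nhdsOn Z x, y ∈ Z := by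
  let _ := zariski V
  exact self_mem_nhdsWithin

theorem eventually_form_ne (Z : Set (ℙ ℂ V)) {x : ℙ ℂ V} {t : Module.Dual ℂ V} (ht : t x.rep ≠ 0) :
    ∀ᶠ y in nhdsOn Z x, t y.rep ≠ 0 := by
  simpa only [polyVal_X] using nhdsOn_ne Z x (MvPolynomial.isHomogeneous_X ℂ t)
    (by rwa [polyVal_X])

/-- A closed set that contains the part of `Z` outside a hyperplane missing some point of `Z`
contains `Z`. -/
theorem subset_of_isClosed (hZ : IsProjectiveVariety Z) (hx : x ∈ Z) {t : Module.Dual ℂ V}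
    (ht : t x.rep ≠ 0) {C : Set (ℙ ℂ V)} (hC : IsClosed[zariski V] C)
    (h : ∀ y ∈ Z, t y.rep ≠ 0 → y ∈ C) : Z ⊆ C := by
  let _ := zariski V
  intro y hy
  by_contra hne
  obtain ⟨w, hwZ, hw, hwC⟩ := hZ.2.isPreirreducible _ Cᶜ (isOpen_form_ne t) hC.isOpen_compl
    ⟨x, hx, ht⟩ ⟨y, hy, hne⟩
  exact hwC (h w hwZ hw)

end Vanishing

/-! ### Germs of polynomials in an affine chart -/

section Chart

variable (Z : Set (ℙ ℂ V)) {x : ℙ ℂ V} {t : Module.Dual ℂ V} (ht : t x.rep ≠ 0)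

/-- Dehomogenization in the chart `t ≠ 0`, as a germ at `x`. -/
def chartGerm : MvPolynomial (Module.Dual ℂ V) ℂ →ₐ[ℂ] localRing Z x :=
  MvPolynomial.aeval (linearGerm Z x t ht)

theorem coe_linearGerm (l : Module.Dual ℂ V) : (linearGerm Z x t ht l : Germ (nhdsOn Z x) ℂ) =
    ((fun y => l y.rep / t y.rep : ℙ ℂ V → ℂ) : Germ (nhdsOn Z x) ℂ) := rfl

theorem coe_algebraMap (c : ℂ) : (algebraMap ℂ (localRing Z x) c : Germ (nhdsOn Z x) ℂ) =
    ((fun _ => c : ℙ ℂ V → ℂ) : Germ (nhdsOn Z x) ℂ) := by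
  change algebraMap ℂ (Germ (nhdsOn Z x) ℂ) c = _
  rw [Algebra.algebraMap_eq_smul_one]
  refine congrArg (fun t : ℙ ℂ V → ℂ => (t : Germ (nhdsOn Z x) ℂ)) ?_
  funext y
  simp

theorem coe_aeval {σ : Type*} (φ : σ → localRing Z x) (F : σ → ℙ ℂ V → ℂ)
    (h : ∀ i, (φ i : Germ (nhdsOn Z x) ℂ) = (F i : Germ (nhdsOn Z x) ℂ)) (p : MvPolynomial σ ℂ) :
    (MvPolynomial.aeval φ p : Germ (nhdsOn Z x) ℂ) =
      ((fun y => MvPolynomial.eval (fun i => F i y) p : ℙ ℂ V → ℂ) : Germ (nhdsOn Z x) ℂ) := by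
  induction p using MvPolynomial.induction_on with
  | C c => simpa using coe_algebraMap Z c
  | add p q hp hq =>
    simp only [map_add, Subalgebra.coe_add, hp, hq]
    rfl
  | mul_X p i hp =>
    simp only [map_mul, Subalgebra.coe_mul, hp, MvPolynomial.aeval_X, h, MvPolynomial.eval_X]
    rfl

theorem coe_chartGerm (f : MvPolynomial (Module.Dual ℂ V) ℂ) :
    (chartGerm Z ht f : Germ (nhdsOn Z x) ℂ) =
      ((fun y => polyVal f ((t y.rep)⁻¹ • y.rep) : ℙ ℂ V → ℂ) : Germ (nhdsOn Z x) ℂ) := by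
  rw [chartGerm, coe_aeval Z _ _ (coe_linearGerm Z ht)]
  simp [polyVal, div_eq_inv_mul]

theorem linearGerm_self : linearGerm Z x t ht t = 1 := by
  refine Subtype.ext ?_
  rw [coe_linearGerm]
  refine Germ.coe_eq.2 ?_
  filter_upwards [eventually_form_ne Z ht] with y hy
  simp [hy]

theorem evalAt_linearGerm (hx : x ∈ Z) (l : Module.Dual ℂ V) :
    evalAt hx (linearGerm Z x t ht l) = l x.rep / t x.rep :=
  evalAt_apply hx _ (coe_linearGerm Z ht l)

theorem evalAt_chartGerm (hx : x ∈ Z) (f : MvPolynomial (Module.Dual ℂ V) ℂ) :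
    evalAt hx (chartGerm Z ht f) = polyVal f ((t x.rep)⁻¹ • x.rep) :=
  evalAt_apply hx _ (coe_chartGerm Z ht f)

theorem linearGerm_mem_maxIdeal (hx : x ∈ Z) {l : Module.Dual ℂ V} :
    linearGerm Z x t ht l ∈ maxIdeal Z x ↔ l x.rep = 0 := by
  rw [mem_maxIdeal hx, evalAt_linearGerm, div_eq_zero_iff, or_iff_left ht]

/-- The bridge between identities in the local ring and homogeneous equations of `Z`. -/
theorem chartGerm_eq_zero_iff (hZ : IsProjectiveVariety Z) (hx : x ∈ Z)
    {f : MvPolynomial (Module.Dual ℂ V) ℂ} {k : ℕ} (hf : f.IsHomogeneous k) :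
    chartGerm Z ht f = 0 ↔ ∀ y ∈ Z, polyVal f y.rep = 0 := by
  rw [← Subtype.coe_inj, coe_chartGerm, ZeroMemClass.coe_zero]
  change _ = ((fun _ => 0 : ℙ ℂ V → ℂ) : Germ (nhdsOn Z x) ℂ) ↔ _
  rw [Germ.coe_eq]
  constructor
  · intro h
    refine vanishes_of_eventually hZ hx hf ?_
    filter_upwards [h, eventually_form_ne Z ht] with y hy hty
    rw [polyVal_smul hf, mul_eq_zero] at hy
    exact hy.resolve_left (pow_ne_zero _ (inv_ne_zero hty))
  · intro h
    filter_upwards [eventually_mem Z x] with y hy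
    rw [polyVal_smul hf, h y hy, mul_zero]

theorem linearGerm_eq_zero_iff (hZ : IsProjectiveVariety Z) (hx : x ∈ Z) {l : Module.Dual ℂ V} :
    linearGerm Z x t ht l = 0 ↔ ∀ y ∈ Z, l y.rep = 0 := by
  simpa [chartGerm, polyVal_X] using
    chartGerm_eq_zero_iff Z ht hZ hx (MvPolynomial.isHomogeneous_X ℂ l)

theorem linearGerm_injective (hZ : IsProjectiveVariety Z) (hx : x ∈ Z) (hn : IsNondegenerate Z) :
    Function.Injective (linearGerm Z x t ht) := by
  rw [injective_iff_map_eq_zero]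
  exact fun l hl => hn l ((linearGerm_eq_zero_iff Z ht hZ hx).1 hl)

/-- Divide numerator and denominator of a fraction by the same power of `t`. The multiplicative form
avoids inverting germs. -/
theorem exists_mul_chartGerm_eq (φ : localRing Z x) :
    ∃ f g : MvPolynomial (Module.Dual ℂ V) ℂ, polyVal g ((t x.rep)⁻¹ • x.rep) ≠ 0 ∧
      φ * chartGerm Z ht g = chartGerm Z ht f := by
  obtain ⟨f, g, ⟨k, hf, hg⟩, hgx, h⟩ := φ.2
  refine ⟨f, g, ?_, Subtype.ext ?_⟩
  · rw [polyVal_smul hg]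
    exact mul_ne_zero (pow_ne_zero _ (inv_ne_zero ht)) hgx
  · rw [Subalgebra.coe_mul, h, coe_chartGerm, coe_chartGerm, ← Germ.coe_mul]
    refine Germ.coe_eq.2 ?_
    filter_upwards [nhdsOn_ne Z x hg hgx] with y hy
    simp only [frac, Pi.mul_apply, polyVal_smul hf, polyVal_smul hg]
    field_simp

/-- Change of chart. -/
theorem linearGerm_mul_linearGerm {t' : Module.Dual ℂ V} (ht' : t' x.rep ≠ 0)
    (l : Module.Dual ℂ V) :
    linearGerm Z x t ht l * linearGerm Z x t' ht' t = linearGerm Z x t' ht' l := by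
  refine Subtype.ext ?_
  rw [Subalgebra.coe_mul]
  simp only [coe_linearGerm]
  rw [← Germ.coe_mul]
  refine Germ.coe_eq.2 ?_
  filter_upwards [eventually_form_ne Z ht] with y hy
  simp only [Pi.mul_apply]
  field_simp

end Chart

/-! ### Homogeneous polynomials in elements of the maximal ideal -/

/-- Forms of degree `k + 1` are sums of products of a variable with a form of degree `k`, because
powers of the degree-one part fill the higher degrees. Scalars are absorbed into the second factor,
so no scalar step is needed. -/
theorem homogeneous_induction {σ : Type*} {motive : ℕ → MvPolynomial σ ℂ → Prop}
    (zero : ∀ k, motive k 0) (C : ∀ c, motive 0 (MvPolynomial.C c))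
    (add : ∀ k P Q, motive k P → motive k Q → motive k (P + Q))
    (X_mul : ∀ k i P, P.IsHomogeneous k → motive k P → motive (k + 1) (MvPolynomial.X i * P))
    {k : ℕ} {P : MvPolynomial σ ℂ} (hP : P.IsHomogeneous k) : motive k P := by
  induction k generalizing P with
  | zero =>
    rw [← MvPolynomial.totalDegree_zero_iff_isHomogeneous, MvPolynomial.totalDegree_eq_zero_iff_eq_C]
      at hP
    rw [hP]
    exact C _
  | succ k ih =>
    have h : P ∈ MvPolynomial.homogeneousSubmodule σ ℂ 1 *
        MvPolynomial.homogeneousSubmodule σ ℂ k := by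
      rw [← MvPolynomial.homogeneousSubmodule_one_pow ℂ k, ← pow_succ',
        MvPolynomial.homogeneousSubmodule_one_pow]
      exact hP
    refine Submodule.mul_induction_on h ?_ (add _)
    intro L hL Q hQ
    rw [MvPolynomial.homogeneousSubmodule_one_eq_span_X] at hL
    induction hL using Submodule.span_induction generalizing Q with
    | mem _ h =>
      obtain ⟨i, rfl⟩ := h
      exact X_mul k i Q hQ (ih hQ)
    | zero => rw [zero_mul]; exact zero _
    | add L L' _ _ h h' =>
      rw [add_mul]
      exact add _ _ _ (h Q hQ) (h' Q hQ)
    | smul c L _ h =>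
      rw [smul_mul_assoc, ← mul_smul_comm]
      exact h _ (Submodule.smul_mem _ c hQ)

section PowMem

variable {A σ : Type*} [CommRing A] [Algebra ℂ A] {I : Ideal A}

theorem aeval_mem_pow {a : σ → A} (ha : ∀ i, a i ∈ I) {k : ℕ} {P : MvPolynomial σ ℂ}
    (hP : P.IsHomogeneous k) : MvPolynomial.aeval a P ∈ I ^ k := by
  refine homogeneous_induction (motive := fun k P => MvPolynomial.aeval a P ∈ I ^ k) ?_ ?_ ?_ ?_ hP
  · simp
  · simp
  · intro k P Q h h'
    rw [map_add]
    exact add_mem h h'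
  · intro k i P _ h
    rw [map_mul, MvPolynomial.aeval_X, pow_succ']
    exact Ideal.mul_mem_mul (ha i) h

/-- Only the classes of the arguments modulo `I²` matter for the leading term. This allows arbitrary
elements of `𝔪` to be replaced by linear forms in the parameters. -/
theorem aeval_sub_aeval_mem_pow {a b : σ → A} (ha : ∀ i, a i ∈ I) (hb : ∀ i, b i ∈ I)
    (hab : ∀ i, a i - b i ∈ I ^ 2) {k : ℕ} {P : MvPolynomial σ ℂ} (hP : P.IsHomogeneous k) :
    MvPolynomial.aeval a P - MvPolynomial.aeval b P ∈ I ^ (k + 1) := by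
  refine homogeneous_induction
    (motive := fun k P => MvPolynomial.aeval a P - MvPolynomial.aeval b P ∈ I ^ (k + 1))
    ?_ ?_ ?_ ?_ hP
  · simp
  · simp
  · intro k P Q h h'
    rw [map_add, map_add, add_sub_add_comm]
    exact add_mem h h'
  · intro k i P hP h
    have e : MvPolynomial.aeval a (MvPolynomial.X i * P) -
        MvPolynomial.aeval b (MvPolynomial.X i * P) =
        a i * (MvPolynomial.aeval a P - MvPolynomial.aeval b P) +
          (a i - b i) * MvPolynomial.aeval b P := by
      simp only [map_mul, MvPolynomial.aeval_X]
      ring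
    rw [e]
    refine add_mem ?_ ?_
    · rw [pow_succ']
      exact Ideal.mul_mem_mul (ha i) h
    · rw [show k + 1 + 1 = 2 + k by ring, pow_add]
      exact Ideal.mul_mem_mul (hab i) (aeval_mem_pow hb hP)

end PowMem

section Local

variable {Z : Set (ℙ ℂ V)} {x : ℙ ℂ V}

theorem smul_mem_pow {k : ℕ} {φ : localRing Z x} (c : ℂ) (h : φ ∈ maxIdeal Z x ^ k) :
    c • φ ∈ maxIdeal Z x ^ k := by
  rw [Algebra.smul_def]
  exact Ideal.mul_mem_left _ _ h

section Linear

variable {t : Module.Dual ℂ V} (ht : t x.rep ≠ 0)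

theorem exists_chartGerm_sub_mem (hx : x ∈ Z) (f : MvPolynomial (Module.Dual ℂ V) ℂ) :
    ∃ l : Module.Dual ℂ V, chartGerm Z ht f - linearGerm Z x t ht l ∈ maxIdeal Z x ^ 2 := by
  induction f using MvPolynomial.induction_on with
  | C c =>
    refine ⟨c • t, ?_⟩
    rw [map_smul, linearGerm_self, chartGerm, MvPolynomial.aeval_C, Algebra.algebraMap_eq_smul_one,
      sub_self]
    exact zero_mem _
  | add f g hf hg =>
    obtain ⟨l, hl⟩ := hf
    obtain ⟨l', hl'⟩ := hg
    refine ⟨l + l', ?_⟩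
    rw [map_add, map_add, add_sub_add_comm]
    exact add_mem hl hl'
  | mul_X f i hf =>
    obtain ⟨l, hl⟩ := hf
    set a := linearGerm Z x t ht l
    set b := linearGerm Z x t ht i
    set α := evalAt hx a
    set β := evalAt hx b
    -- First-order expansion of a product: `ab ≡ αb + βa - αβ` modulo `𝔪²`, with `t` standing for
    -- the constant `1`.
    refine ⟨α • i + β • l - (α * β) • t, ?_⟩
    rw [map_mul, chartGerm, MvPolynomial.aeval_X, ← chartGerm, map_sub, map_add, map_smul, map_smul,
      map_smul, linearGerm_self]
    have e : chartGerm Z ht f * b - (α • b + β • a - (α * β) • (1 : localRing Z x)) =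
        (chartGerm Z ht f - a) * b +
          (a - algebraMap ℂ _ α) * (b - algebraMap ℂ _ β) := by
      simp only [Algebra.smul_def, map_mul]
      ring
    change chartGerm Z ht f * b - _ ∈ _
    rw [e]
    refine add_mem (Ideal.mul_mem_right _ _ hl) ?_
    rw [pow_two]
    exact Ideal.mul_mem_mul (sub_algebraMap_mem_maxIdeal hx a) (sub_algebraMap_mem_maxIdeal hx b)

/-- The maximal ideal is generated by linear forms modulo its square. -/
theorem exists_sub_linearGerm_mem (hx : x ∈ Z) {φ : localRing Z x} (hφ : φ ∈ maxIdeal Z x) :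
    ∃ l : Module.Dual ℂ V, l x.rep = 0 ∧ φ - linearGerm Z x t ht l ∈ maxIdeal Z x ^ 2 := by
  obtain ⟨f, g, hg, h⟩ := exists_mul_chartGerm_eq Z ht φ
  rw [← evalAt_chartGerm Z ht hx] at hg
  obtain ⟨l, hl⟩ := exists_chartGerm_sub_mem ht hx f
  set G := chartGerm Z ht g
  set c := evalAt hx G
  have hmem : φ - linearGerm Z x t ht (c⁻¹ • l) ∈ maxIdeal Z x ^ 2 := by
    -- From `φ G = f` one gets `c φ = f - φ (G - c)`, and the last product lies in `𝔪²`.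
    have e : φ - linearGerm Z x t ht (c⁻¹ • l) =
        c⁻¹ • ((chartGerm Z ht f - linearGerm Z x t ht l) - φ * (G - algebraMap ℂ _ c)) := by
      rw [mul_sub, h, map_smul, sub_sub_sub_cancel_left, smul_sub, mul_comm φ, ← Algebra.smul_def,
        smul_smul, inv_mul_cancel₀ hg, one_smul]
    rw [e]
    refine smul_mem_pow _ (sub_mem hl ?_)
    rw [pow_two]
    exact Ideal.mul_mem_mul hφ (sub_algebraMap_mem_maxIdeal hx G)
  refine ⟨_, ?_, hmem⟩
  have h1 := sub_mem hφ (Ideal.pow_le_self two_ne_zero hmem)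
  rw [sub_sub_cancel] at h1
  exact (linearGerm_mem_maxIdeal Z ht hx).1 h1

end Linear

/-- `z` is a finite family in the maximal ideal whose classes span the cotangent space. -/
structure Spans {n : ℕ} (z : Fin n → localRing Z x) : Prop where
  mem : ∀ i, z i ∈ maxIdeal Z x
  span : ∀ φ ∈ maxIdeal Z x, ∃ c : Fin n → ℂ, φ - ∑ i, c i • z i ∈ maxIdeal Z x ^ 2

variable {n : ℕ} {z : Fin n → localRing Z x}

theorem Spans.exists_linear (hz : Spans z) {φ : localRing Z x} (hφ : φ ∈ maxIdeal Z x) :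
    ∃ L : MvPolynomial (Fin n) ℂ, L.IsHomogeneous 1 ∧
      φ - MvPolynomial.aeval z L ∈ maxIdeal Z x ^ 2 := by
  obtain ⟨c, hc⟩ := hz.span φ hφ
  refine ⟨∑ i, MvPolynomial.C (c i) * MvPolynomial.X i, ?_, ?_⟩
  · exact MvPolynomial.IsHomogeneous.sum _ _ _ fun i _ => MvPolynomial.isHomogeneous_C_mul_X _ _
  · simpa [Algebra.smul_def] using hc

/-- The monomials of degree `k` in the parameters span `𝔪^k / 𝔪^(k+1)`, by induction on `k`. -/
theorem Spans.exists_homogeneous (hz : Spans z) (hx : x ∈ Z) (k : ℕ) {φ : localRing Z x}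
    (hφ : φ ∈ maxIdeal Z x ^ k) : ∃ P : MvPolynomial (Fin n) ℂ, P.IsHomogeneous k ∧
      φ - MvPolynomial.aeval z P ∈ maxIdeal Z x ^ (k + 1) := by
  induction k generalizing φ with
  | zero =>
    refine ⟨MvPolynomial.C (evalAt hx φ), MvPolynomial.isHomogeneous_C _ _, ?_⟩
    rw [MvPolynomial.aeval_C, zero_add, pow_one]
    exact sub_algebraMap_mem_maxIdeal hx φ
  | succ k ih =>
    rw [pow_succ] at hφ
    refine Submodule.mul_induction_on hφ ?_ ?_
    · intro a ha b hb
      obtain ⟨P, hP, hP'⟩ := ih ha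
      obtain ⟨L, hL, hL'⟩ := hz.exists_linear hb
      refine ⟨P * L, hP.mul hL, ?_⟩
      have e : a * b - MvPolynomial.aeval z (P * L) = (a - MvPolynomial.aeval z P) * b +
          MvPolynomial.aeval z P * (b - MvPolynomial.aeval z L) := by
        rw [map_mul]
        ring
      rw [e]
      refine add_mem ?_ ?_
      · rw [pow_succ]
        exact Ideal.mul_mem_mul hP' hb
      · rw [show k + 1 + 1 = k + 2 by ring, pow_add]
        exact Ideal.mul_mem_mul (aeval_mem_pow hz.mem hP) hL'
    · rintro a b ⟨P, hP, hP'⟩ ⟨Q, hQ, hQ'⟩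
      refine ⟨P + Q, hP.add hQ, ?_⟩
      rw [map_add, add_sub_add_comm]
      exact add_mem hP' hQ'

/-! ### Weights -/

/-- An algebra endomorphism that preserves the maximal ideal and multiplies each `z i` by `q`. -/
structure Scales (z : Fin n → localRing Z x) (S : localRing Z x →ₐ[ℂ] localRing Z x) (q : ℂ) :
    Prop where
  le_comap : maxIdeal Z x ≤ (maxIdeal Z x).comap S
  apply : ∀ i, S (z i) = q • z i

variable {S : localRing Z x →ₐ[ℂ] localRing Z x} {q : ℂ}

theorem Scales.aeval (hS : Scales z S q) {k : ℕ} {P : MvPolynomial (Fin n) ℂ}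
    (hP : P.IsHomogeneous k) :
    S (MvPolynomial.aeval z P) = q ^ k • MvPolynomial.aeval z P := by
  refine homogeneous_induction
    (motive := fun k P => S (MvPolynomial.aeval z P) = q ^ k • MvPolynomial.aeval z P) ?_ ?_ ?_ ?_ hP
  · simp
  · intro c
    simp
  · intro k P Q h h'
    rw [map_add, map_add, h, h', smul_add]
  · intro k i P _ h
    rw [map_mul, map_mul, h, MvPolynomial.aeval_X, hS.apply, smul_mul_smul_comm, pow_succ']

theorem Scales.map_mem_pow (hS : Scales z S q) {k : ℕ} {φ : localRing Z x}
    (hφ : φ ∈ maxIdeal Z x ^ k) : S φ ∈ maxIdeal Z x ^ k := by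
  have h := Ideal.le_comap_pow (S : localRing Z x →+* localRing Z x) (K := maxIdeal Z x) k
  exact h (Ideal.pow_right_mono hS.le_comap k hφ)

/-- `S` acts on `𝔪^k / 𝔪^(k+1)` as `q^k`, so an eigenvector with another eigenvalue has zero class
there. -/
theorem Scales.mem_pow_succ (hS : Scales z S q) (hz : Spans z) (hx : x ∈ Z) {k : ℕ} {c : ℂ}
    (hc : c ≠ q ^ k) {φ : localRing Z x} (hφ : φ ∈ maxIdeal Z x ^ k) (h : S φ = c • φ) :
    φ ∈ maxIdeal Z x ^ (k + 1) := by
  obtain ⟨P, hP, hr⟩ := hz.exists_homogeneous hx k hφ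
  set r := φ - MvPolynomial.aeval z P
  have e : (c - q ^ k) • φ = S r - q ^ k • r := by
    simp only [r, map_sub, hS.aeval hP, h, smul_sub, sub_smul]
    abel
  have h1 : (c - q ^ k) • φ ∈ maxIdeal Z x ^ (k + 1) := by
    rw [e]
    exact sub_mem (hS.map_mem_pow hr) (smul_mem_pow _ hr)
  have h2 := smul_mem_pow (c - q ^ k)⁻¹ h1
  rwa [smul_smul, inv_mul_cancel₀ (sub_ne_zero.2 hc), one_smul] at h2

theorem Scales.mem_pow_of_le (hS : Scales z S q) (hz : Spans z) (hx : x ∈ Z) {k₀ k₁ : ℕ} {c : ℂ}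
    (hc : ∀ k, k₀ ≤ k → k < k₁ → c ≠ q ^ k) (hk : k₀ ≤ k₁) {φ : localRing Z x}
    (hφ : φ ∈ maxIdeal Z x ^ k₀) (h : S φ = c • φ) : φ ∈ maxIdeal Z x ^ k₁ := by
  induction k₁, hk using Nat.le_induction with
  | base => exact hφ
  | succ k hk ih =>
    exact hS.mem_pow_succ hz hx (hc k hk (Nat.lt_succ_self k))
      (ih fun j h1 h2 => hc j h1 (h2.trans (Nat.lt_succ_self k))) h

theorem Scales.eq_zero (hS : Scales z S q) (hz : Spans z) (hx : IsNonsingularAt Z x) {k₀ : ℕ}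
    {c : ℂ} (hc : ∀ k ≥ k₀, c ≠ q ^ k) {φ : localRing Z x} (hφ : φ ∈ maxIdeal Z x ^ k₀)
    (h : S φ = c • φ) : φ = 0 :=
  eq_zero_of_forall_mem_pow hx k₀ fun _ hk =>
    hS.mem_pow_of_le hz hx.1 (fun j hj _ => hc j hj) hk hφ h

/-- The eigenvalue differs from `q^k` for `k < d`, which pushes `φ` into `𝔪^d`. Subtracting its part
of degree `d` leaves an eigenvector in `𝔪^(d+1)` with eigenvalue `q^d`, which must vanish. -/
theorem Scales.eq_aeval (hS : Scales z S q) (hz : Spans z) (hx : IsNonsingularAt Z x) {k₀ d : ℕ}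
    (hd : k₀ ≤ d) (hq : Function.Injective fun k : ℕ => q ^ k) {φ : localRing Z x}
    (hφ : φ ∈ maxIdeal Z x ^ k₀) (h : S φ = q ^ d • φ) :
    ∃ P : MvPolynomial (Fin n) ℂ, P.IsHomogeneous d ∧ φ = MvPolynomial.aeval z P := by
  have hφd := hS.mem_pow_of_le hz hx.1 (k₁ := d) (fun k _ hk he => hk.ne' (hq he)) hd hφ h
  obtain ⟨P, hP, hr⟩ := hz.exists_homogeneous hx.1 d hφd
  refine ⟨P, hP, sub_eq_zero.1 ?_⟩
  refine hS.eq_zero hz hx (c := q ^ d) (fun k hk he => ?_) hr ?_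
  · exact absurd (hq he) (by omega)
  · rw [map_sub, h, hS.aeval hP, smul_sub]

end Local

/-! ### The action on the local ring -/

section Pullback

variable {Z : Set (ℙ ℂ V)} {x : ℙ ℂ V} (g : LinearMap.GeneralLinearGroup ℂ V)

theorem tendsto_nhdsOn (hZ : ∀ y ∈ Z, g • y ∈ Z) (hx : g • x = x) :
    Tendsto (fun y => g • y) (nhdsOn Z x) (nhdsOn Z x) := by
  let _ := zariski V
  refine tendsto_nhdsWithin_iff.2 ⟨?_, ?_⟩
  · have h := (continuous_smul_zariski g).tendsto x
    rw [hx] at h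
    exact h.mono_left nhdsWithin_le_nhds
  · filter_upwards [eventually_mem Z x] with y hy using hZ y hy

theorem IsFracGerm.compTendsto (h : Tendsto (fun y => g • y) (nhdsOn Z x) (nhdsOn Z x))
    (hx : g • x = x) {f f' : MvPolynomial (Module.Dual ℂ V) ℂ} {φ : Germ (nhdsOn Z x) ℂ}
    (hφ : IsFracGerm Z x f f' φ) :
    IsFracGerm Z x (MvPolynomial.rename (fun l : Module.Dual ℂ V => l ∘ₗ (g : V →ₗ[ℂ] V)) f)
      (MvPolynomial.rename (fun l : Module.Dual ℂ V => l ∘ₗ (g : V →ₗ[ℂ] V)) f')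
      (φ.compTendsto _ h) := by
  obtain ⟨⟨k, hf, hf'⟩, hne, rfl⟩ := hφ
  refine ⟨⟨k, hf.rename_isHomogeneous, hf'.rename_isHomogeneous⟩, ?_, ?_⟩
  · rwa [Ne, ← polyVal_smul_rep_eq_zero hf', hx]
  · rw [Germ.coe_compTendsto]
    congr 1
    funext y
    obtain ⟨a, ha⟩ := smul_rep g y
    simp only [Function.comp, frac, ha, polyVal_smul hf, polyVal_smul hf', polyVal_rename]
    exact mul_div_mul_left _ _ (pow_ne_zero _ a.ne_zero)

/-- The automorphism of the local ring induced by a projective transformation that preserves `Z`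
and fixes `x`. -/
def pullback (hZ : ∀ y ∈ Z, g • y ∈ Z) (hx : g • x = x) : localRing Z x →ₐ[ℂ] localRing Z x where
  toFun φ := ⟨φ.1.compTendsto _ (tendsto_nhdsOn g hZ hx), by
    obtain ⟨f, f', h⟩ := φ.2
    exact ⟨_, _, h.compTendsto g _ hx⟩⟩
  map_one' := rfl
  map_zero' := rfl
  map_mul' := by
    rintro ⟨a, ha⟩ ⟨b, hb⟩
    refine Subtype.ext ?_
    induction a using Germ.inductionOn with | _ f =>
    induction b using Germ.inductionOn with | _ g => rfl
  map_add' := by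
    rintro ⟨a, ha⟩ ⟨b, hb⟩
    refine Subtype.ext ?_
    induction a using Germ.inductionOn with | _ f =>
    induction b using Germ.inductionOn with | _ g => rfl
  commutes' c := by
    refine Subtype.ext ?_
    change (algebraMap ℂ (localRing Z x) c : Germ (nhdsOn Z x) ℂ).compTendsto _
      (tendsto_nhdsOn g hZ hx) = _
    rw [coe_algebraMap]
    rfl

variable (hZ : ∀ y ∈ Z, g • y ∈ Z) (hx : g • x = x)

theorem coe_pullback {φ : localRing Z x} {F : ℙ ℂ V → ℂ}
    (h : (φ : Germ (nhdsOn Z x) ℂ) = (F : Germ (nhdsOn Z x) ℂ)) :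
    (pullback g hZ hx φ : Germ (nhdsOn Z x) ℂ) =
      ((fun y => F (g • y) : ℙ ℂ V → ℂ) : Germ (nhdsOn Z x) ℂ) := by
  change (φ : Germ (nhdsOn Z x) ℂ).compTendsto _ (tendsto_nhdsOn g hZ hx) = _
  rw [h]
  rfl

theorem maxIdeal_le_comap_pullback (h : x ∈ Z) :
    maxIdeal Z x ≤ (maxIdeal Z x).comap (pullback g hZ hx) := by
  intro φ hφ
  obtain ⟨F, hF⟩ : ∃ F : ℙ ℂ V → ℂ, (F : Germ (nhdsOn Z x) ℂ) = φ := by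
    obtain ⟨f, f', h⟩ := φ.2
    exact ⟨_, h.2.2.symm⟩
  rw [Ideal.mem_comap, mem_maxIdeal h, evalAt_apply h _ (coe_pullback g hZ hx hF.symm), hx,
    ← evalAt_apply h _ hF.symm, ← mem_maxIdeal h]
  exact hφ

theorem ActsAsScalar.pullback_sub_mem {c : ℂ} (h : ActsAsScalar Z x g c) {φ : localRing Z x}
    (hφ : φ ∈ maxIdeal Z x) : pullback g hZ hx φ - c • φ ∈ maxIdeal Z x ^ 2 := by
  obtain ⟨F, hF⟩ : ∃ F : ℙ ℂ V → ℂ, (F : Germ (nhdsOn Z x) ℂ) = φ := by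
    obtain ⟨f, f', h⟩ := φ.2
    exact ⟨_, h.2.2.symm⟩
  exact h F φ _ hF.symm (coe_pullback g hZ hx hF.symm) hφ

theorem pullback_linearGerm {t l : Module.Dual ℂ V} (ht : t x.rep ≠ 0) {α β : ℂ} (hα : α ≠ 0)
    (htα : ∀ v, t ((g : V →ₗ[ℂ] V) v) = α * t v) (hlβ : ∀ v, l ((g : V →ₗ[ℂ] V) v) = β * l v) :
    pullback g hZ hx (linearGerm Z x t ht l) = (β / α) • linearGerm Z x t ht l := by
  rw [← map_smul]
  refine Subtype.ext ?_
  rw [coe_pullback g hZ hx (coe_linearGerm Z ht l), coe_linearGerm]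
  congr 1
  funext y
  obtain ⟨a, ha⟩ := smul_rep g y
  simp only [ha, map_smul, htα, hlβ, LinearMap.smul_apply, smul_eq_mul]
  have := a.ne_zero
  field_simp

end Pullback

/-! ### Parameters at a nonsingular point -/

section Parameters

variable {Z : Set (ℙ ℂ V)} {x : ℙ ℂ V}

theorem smul_toCotangent (c : ℂ) (a : maxIdeal Z x) :
    (maxIdeal Z x).toCotangent (c • a) = c • (maxIdeal Z x).toCotangent a := rfl

theorem localRing_smul_cotangent (hx : x ∈ Z) (φ : localRing Z x) (a : Cotangent Z x) :
    φ • a = evalAt hx φ • a := by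
  have h := Ideal.Cotangent.smul_eq_zero_of_mem (sub_algebraMap_mem_maxIdeal hx φ) a
  rw [sub_smul, sub_eq_zero, algebraMap_smul] at h
  exact h

/-- Regularity provides as many generators of `𝔪` as the Krull dimension. Their classes span `𝔪 /
𝔪²` over `ℂ`, because the local ring acts there through evaluation at `x`. -/
theorem finrank_cotangent_le (h : IsNonsingularAt Z x) :
    (Module.finrank ℂ (Cotangent Z x) : WithBot ℕ∞) ≤ ringKrullDim (localRing Z x) := by
  have := h.2
  rw [← IsRegularLocalRing.spanFinrank_maximalIdeal, ← maxIdeal_eq h.1]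
  obtain ⟨s, hs, hspan⟩ := Submodule.FG.exists_span_finset_card_eq_spanFinrank
    ((isNoetherianRing_iff_ideal_fg _).1 inferInstance (maxIdeal Z x))
  rw [← hs]
  norm_cast
  have hmem : ∀ a ∈ s, a ∈ maxIdeal Z x := fun a ha => by
    rw [← hspan]
    exact Submodule.subset_span ha
  let f : s → Cotangent Z x := fun a => (maxIdeal Z x).toCotangent ⟨a, hmem a a.2⟩
  have htop : Submodule.span ℂ (Set.range f) = ⊤ := by
    rw [eq_top_iff]
    rintro a -
    obtain ⟨⟨φ, hφ⟩, rfl⟩ := Ideal.toCotangent_surjective _ a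
    have hle : ∀ ψ, ψ ∈ Submodule.span (localRing Z x) (s : Set (localRing Z x)) →
        ψ ∈ maxIdeal Z x := fun ψ hψ => by rwa [hspan] at hψ
    have key : ∀ ψ (hψ : ψ ∈ Submodule.span (localRing Z x) (s : Set (localRing Z x))),
        (maxIdeal Z x).toCotangent ⟨ψ, hle ψ hψ⟩ ∈ Submodule.span ℂ (Set.range f) := by
      intro ψ hψ
      induction hψ using Submodule.span_induction with
      | mem a ha => exact Submodule.subset_span ⟨⟨a, ha⟩, rfl⟩
      | zero => exact zero_mem _
      | add a b ha hb iha ihb =>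
        have e := add_mem iha ihb
        rwa [← map_add] at e
      | smul c a ha iha =>
        have e := Submodule.smul_mem _ (evalAt h.1 c) iha
        rw [← localRing_smul_cotangent h.1] at e
        have e' := (maxIdeal Z x).toCotangent.map_smul c ⟨a, hle a ha⟩
        rw [← e'] at e
        exact e
    exact key φ (by rwa [hspan])
  rw [← finrank_top ℂ (Cotangent Z x), ← htop]
  exact (finrank_range_le_card f).trans (Fintype.card_coe s).le

variable {n : ℕ} {z : Fin n → localRing Z x}

theorem evalAt_aeval (hz : Spans z) (hx : x ∈ Z) (p : MvPolynomial (Fin n) ℂ) :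
    evalAt hx (MvPolynomial.aeval z p) = MvPolynomial.eval 0 p := by
  rw [← AlgHom.comp_apply, MvPolynomial.comp_aeval, MvPolynomial.aeval_def,
    ← MvPolynomial.coe_eval₂Hom]
  have h0 : (fun i => evalAt hx (z i)) = 0 := funext fun i => (mem_maxIdeal hx).1 (hz.mem i)
  rw [h0]
  rfl

/-- If every germ is a quotient of polynomials in `n = dim T_x^* Z` local parameters, then the
parameters are algebraically independent. -/
theorem Spans.aeval_injective (hz : Spans z) (hx : IsNonsingularAt Z x)
    (hn : Module.finrank ℂ (Cotangent Z x) = n)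
    (hsurj : ∀ φ : localRing Z x, ∃ F G : MvPolynomial (Fin n) ℂ, MvPolynomial.eval 0 G ≠ 0 ∧
      φ * MvPolynomial.aeval z G = MvPolynomial.aeval z F) :
    Function.Injective (MvPolynomial.aeval z : MvPolynomial (Fin n) ℂ →ₐ[ℂ] localRing Z x) := by
  have := hx.2
  let R := MvPolynomial (Fin n) ℂ
  let θ : R →+* localRing Z x := (MvPolynomial.aeval z : R →ₐ[ℂ] localRing Z x)
  let P : Ideal R := RingHom.ker (MvPolynomial.eval (0 : Fin n → ℂ))
  have : P.IsPrime := RingHom.ker_isPrime _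
  have hunit : ∀ G : P.primeCompl, IsUnit (θ G) := fun G => by
    refine isUnit_of_evalAt_ne hx.1 ?_
    change evalAt hx.1 (MvPolynomial.aeval z G.1) ≠ 0
    rw [evalAt_aeval hz]
    exact G.2
  -- The polynomial ring localized at the origin maps onto the local ring of `Z`.
  let Θ : Localization.AtPrime P →+* localRing Z x := IsLocalization.lift hunit
  have hΘ : Function.Surjective Θ := fun φ => by
    obtain ⟨F, G, hG, h⟩ := hsurj φ
    refine ⟨IsLocalization.mk' (Localization.AtPrime P) F (⟨G, hG⟩ : P.primeCompl), ?_⟩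
    rw [IsLocalization.lift_mk'_spec, mul_comm]
    exact h.symm
  rw [injective_iff_map_eq_zero]
  intro f hf
  by_contra hne
  have hinj : Function.Injective (algebraMap R (Localization.AtPrime P)) :=
    IsLocalization.injective _ P.primeCompl_le_nonZeroDivisors
  -- A nonzero kernel element of a domain costs one dimension, so the local ring would have
  -- dimension at most `n - 1`, although its cotangent space has dimension `n`.
  have h1 := ringKrullDim_succ_le_of_surjective Θ hΘ
    (mem_nonZeroDivisors_of_ne_zero ((map_ne_zero_iff _ hinj).2 hne))
    (by rw [IsLocalization.lift_eq]; exact hf)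
  rw [IsLocalization.AtPrime.ringKrullDim_eq_height P (Localization.AtPrime P)] at h1
  have h2 := (h1.trans (Ideal.height_le_ringKrullDim_of_ne_top Ideal.IsPrime.ne_top')).trans_eq
    MvPolynomial.ringKrullDim_of_isNoetherianRing
  rw [ringKrullDim_eq_zero_of_field, zero_add, Nat.card_eq_fintype_card, Fintype.card_fin] at h2
  have h3 := (add_le_add_left (finrank_cotangent_le hx) 1).trans h2
  rw [hn] at h3
  norm_cast at h3
  omega

end Parameters

/-! ### Adapted coordinates -/

theorem two_zpow_injective : Function.Injective fun k : ℤ => (2 : ℂ) ^ k := by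
  intro a b h
  have h' : (2 : ℝ) ^ a = 2 ^ b := by
    refine Complex.ofReal_injective ?_
    push_cast
    exact h
  exact zpow_right_injective₀ two_pos (by norm_num) h'

section Adapted

variable {Z : Set (ℙ ℂ V)} {x : ℙ ℂ V} {ρ : ℂˣ →* LinearMap.GeneralLinearGroup ℂ V}
  {n m : ℕ} {b : Module.Basis (CoordIdx n m) ℂ (Module.Dual ℂ V)}

/-- The germs `z_i / t`. -/
def IsAdapted.zGerm (hb : IsAdapted Z x ρ b) (i : Fin n) : localRing Z x :=
  linearGerm Z x (b none) hb.chart (b (some (Sum.inl i)))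

/-- The germs `u_j / t`. -/
def IsAdapted.uGerm (hb : IsAdapted Z x ρ b) (j : Fin m) : localRing Z x :=
  linearGerm Z x (b none) hb.chart (b (some (Sum.inr j)))

theorem sum_coords (l : Module.Dual ℂ V) :
    l = b.repr l none • b none + (∑ i, b.repr l (some (Sum.inl i)) • b (some (Sum.inl i)) +
      ∑ j, b.repr l (some (Sum.inr j)) • b (some (Sum.inr j))) := by
  conv_lhs => rw [← b.sum_repr l, Fintype.sum_option, Fintype.sum_sum_type]

/-- Linear forms vanishing at `x` span `𝔪 / 𝔪²`; such a form has no `t`-component, and its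
`u`-components lie in `𝔪²`. -/
theorem IsAdapted.spans (hb : IsAdapted Z x ρ b) (hx : x ∈ Z) : Spans hb.zGerm where
  mem i := (linearGerm_mem_maxIdeal Z hb.chart hx).2 (hb.origin _)
  span φ hφ := by
    obtain ⟨l, hl, h⟩ := exists_sub_linearGerm_mem hb.chart hx hφ
    have h0 : b.repr l none = 0 := by
      have e := congrArg (fun l : Module.Dual ℂ V => l x.rep) (sum_coords (b := b) l)
      simp only [hl, LinearMap.add_apply, LinearMap.sum_apply, LinearMap.smul_apply, hb.origin,
        smul_eq_mul, mul_zero, Finset.sum_const_zero, add_zero] at e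
      exact (mul_eq_zero.1 e.symm).resolve_right hb.chart
    refine ⟨fun i => b.repr l (some (Sum.inl i)), ?_⟩
    have e : linearGerm Z x (b none) hb.chart l =
        ∑ i, b.repr l (some (Sum.inl i)) • hb.zGerm i +
          ∑ j, b.repr l (some (Sum.inr j)) • hb.uGerm j := by
      conv_lhs => rw [sum_coords (b := b) l, h0, zero_smul, zero_add]
      simp only [map_add, map_sum, map_smul]
      rfl
    rw [e, ← sub_sub] at h
    have h' := add_mem h (sum_mem fun j (_ : j ∈ Finset.univ) =>
      smul_mem_pow (b.repr l (some (Sum.inr j))) (hb.tangent j))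
    rwa [show ∑ j, b.repr l (some (Sum.inr j)) •
      linearGerm Z x (b none) hb.chart (b (some (Sum.inr j))) =
        ∑ j, b.repr l (some (Sum.inr j)) • hb.uGerm j from rfl, sub_add_cancel] at h'

/-- The classes of the germs `z_i / t` form a basis of the cotangent space. -/
def IsAdapted.cotangentBasis (hb : IsAdapted Z x ρ b) (hx : x ∈ Z) :
    Module.Basis (Fin n) ℂ (Cotangent Z x) :=
  basisOfTopLeSpanOfCardEqFinrank
    (fun i => (maxIdeal Z x).toCotangent ⟨hb.zGerm i, (hb.spans hx).mem i⟩)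
    (by
      rintro a -
      obtain ⟨⟨φ, hφ⟩, rfl⟩ := Ideal.toCotangent_surjective _ a
      obtain ⟨c, hc⟩ := (hb.spans hx).span φ hφ
      have e : (maxIdeal Z x).toCotangent ⟨φ, hφ⟩ = ∑ i, c i •
          (maxIdeal Z x).toCotangent ⟨hb.zGerm i, (hb.spans hx).mem i⟩ := by
        simp only [← smul_toCotangent]
        rw [← map_sum, Ideal.toCotangent_eq]
        simpa using hc
      rw [e]
      exact sum_mem fun i _ => Submodule.smul_mem _ _ (Submodule.subset_span ⟨i, rfl⟩))
    (by rw [hb.finrank_eq, Fintype.card_fin])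

theorem IsAdapted.cotangentBasis_apply (hb : IsAdapted Z x ρ b) (hx : x ∈ Z) (i : Fin n) :
    hb.cotangentBasis hx i = (maxIdeal Z x).toCotangent ⟨hb.zGerm i, (hb.spans hx).mem i⟩ := by
  rw [cotangentBasis, coe_basisOfTopLeSpanOfCardEqFinrank]

theorem IsAdapted.zGerm_notMem (hb : IsAdapted Z x ρ b) (hx : x ∈ Z) (i : Fin n) :
    hb.zGerm i ∉ maxIdeal Z x ^ 2 := by
  have h := (hb.cotangentBasis hx).ne_zero i
  rwa [hb.cotangentBasis_apply, Ne, Ideal.toCotangent_eq_zero] at h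

/-- The element `2` of the multiplicative group. -/
def unitTwo : ℂˣ := Units.mk0 2 two_ne_zero

/-- The automorphism of the local ring given by the action of `2`. -/
def IsEulerType.doubling (h : IsEulerType Z x ρ) : localRing Z x →ₐ[ℂ] localRing Z x :=
  pullback (ρ unitTwo) (h.preserves _) (h.fixed _)

theorem IsEulerType.doubling_linearGerm (h : IsEulerType Z x ρ) {t l : Module.Dual ℂ V}
    (ht : t x.rep ≠ 0) {w w' : ℤ}
    (hw : ∀ (s : ℂˣ) (v : V), t ((ρ s : V →ₗ[ℂ] V) v) = (s : ℂ) ^ w * t v)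
    (hw' : ∀ (s : ℂˣ) (v : V), l ((ρ s : V →ₗ[ℂ] V) v) = (s : ℂ) ^ w' * l v) :
    h.doubling (linearGerm Z x t ht l) = (2 : ℂ) ^ (w' - w) • linearGerm Z x t ht l := by
  rw [zpow_sub₀ two_ne_zero]
  exact pullback_linearGerm _ _ _ ht (zpow_ne_zero _ two_ne_zero) (hw unitTwo) (hw' unitTwo)

theorem smul_eq_of_weights {w : ℤ}
    (hw : ∀ i (s : ℂˣ) (v : V), b i ((ρ s : V →ₗ[ℂ] V) v) = (s : ℂ) ^ w * b i v)
    [FiniteDimensional ℂ V] (s : ℂˣ) (y : ℙ ℂ V) : ρ s • y = y := by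
  have e : (ρ s : V →ₗ[ℂ] V) y.rep = (s : ℂ) ^ w • y.rep := by
    rw [← sub_eq_zero, ← Module.forall_dual_apply_eq_zero_iff ℂ]
    intro l
    rw [← b.sum_repr l]
    simp only [LinearMap.sum_apply, LinearMap.smul_apply, map_sub, hw, map_smul, Finset.smul_sum]
    rw [← Finset.sum_sub_distrib]
    refine Finset.sum_eq_zero fun i _ => ?_
    simp only [smul_eq_mul]
    ring
  conv_rhs => rw [← y.mk_rep]
  conv_lhs => rw [← y.mk_rep]
  rw [Projectivization.smul_mk, Projectivization.mk_eq_mk_iff]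
  exact ⟨s ^ w, by rw [Units.smul_def, Units.val_zpow_eq_zpow_val]; exact e.symm⟩

/-- All `z_i / t` have the same weight, which is nonzero since `x` is an isolated fixed point. -/
theorem IsAdapted.exists_scales [FiniteDimensional ℂ V] (hb : IsAdapted Z x ρ b)
    (h : IsEulerType Z x ρ) (hZ : IsProjectiveVariety Z) (hn : IsNondegenerate Z) :
    ∃ q : ℂ, Scales hb.zGerm h.doubling q ∧ Function.Injective fun k : ℕ => q ^ k := by
  have hx := h.nonsingular.1
  have hle : maxIdeal Z x ≤ (maxIdeal Z x).comap h.doubling := maxIdeal_le_comap_pullback _ _ _ hx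
  choose w hw using hb.eigen
  -- With no parameters the scaling condition is empty, and any `q` with distinct powers will do.
  rcases Nat.eq_zero_or_pos n with rfl | hpos
  · refine ⟨2, ⟨hle, fun i => i.elim0⟩, fun i j hij => ?_⟩
    have := two_zpow_injective (a₁ := (i : ℤ)) (a₂ := (j : ℤ)) (by simpa using hij)
    exact_mod_cast this
  obtain ⟨c, hc⟩ := h.scalar unitTwo
  -- The exact eigenvalue of `z_i / t` and the Euler scalar `c` agree because the class of `z_i / t`
  -- modulo `𝔪²` is nonzero.
  have hwt : ∀ i, (2 : ℂ) ^ (w (some (Sum.inl i)) - w none) = c := fun i => by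
    have h1 := hc.pullback_sub_mem _ (h.preserves _) (h.fixed _) ((hb.spans hx).mem i)
    have h2 : h.doubling (hb.zGerm i) = _ :=
      h.doubling_linearGerm hb.chart (hw none) (hw (some (Sum.inl i)))
    change h.doubling (hb.zGerm i) - c • hb.zGerm i ∈ _ at h1
    rw [h2] at h1
    change _ • hb.zGerm i - c • hb.zGerm i ∈ _ at h1
    rw [← sub_smul] at h1
    by_contra hne
    have h3 := smul_mem_pow ((2 : ℂ) ^ (w (some (Sum.inl i)) - w none) - c)⁻¹ h1
    rw [smul_smul, inv_mul_cancel₀ (sub_ne_zero.2 hne), one_smul] at h3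
    exact hb.zGerm_notMem hx i h3
  have hS : Scales hb.zGerm h.doubling c := ⟨hle, fun i => by
    rw [← hwt i]
    exact h.doubling_linearGerm hb.chart (hw none) (hw (some (Sum.inl i)))⟩
  refine ⟨c, hS, ?_⟩
  let i₀ : Fin n := ⟨0, hpos⟩
  set a := w (some (Sum.inl i₀)) - w none with ha
  have hca : c = (2 : ℂ) ^ a := (hwt i₀).symm
  rcases eq_or_ne a 0 with h0 | h0
  -- If `q = 1`, a `u_j` of weight different from that of `t` would have zero germ, against
  -- nondegeneracy. So all coordinates have one weight, every point is fixed, and isolation makes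
  -- `x` its own neighbourhood in `Z`. Then `z_{i₀} / t = 0`, which is impossible.
  · exfalso
    rw [h0, zpow_zero] at hca
    have hz : ∀ i, w (some (Sum.inl i)) = w none := fun i => by
      have := two_zpow_injective (a₁ := w (some (Sum.inl i)) - w none) (a₂ := 0)
        (by simpa [hca] using hwt i)
      omega
    have hu : ∀ j, w (some (Sum.inr j)) = w none := fun j => by
      by_contra hne
      have h1 := h.doubling_linearGerm hb.chart (hw none) (hw (some (Sum.inr j)))
      have h2 := hS.eq_zero (hb.spans hx) h.nonsingular (k₀ := 2) (fun k _ hk => hne ?_)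
        (hb.tangent j) h1
      · exact b.ne_zero _ (linearGerm_injective Z hb.chart hZ hx hn (h2.trans (map_zero _).symm))
      · rw [hca, one_pow] at hk
        have := two_zpow_injective (a₁ := w (some (Sum.inr j)) - w none) (a₂ := 0) (by simpa using hk)
        omega
    have hall : ∀ i (s : ℂˣ) (v : V), b i ((ρ s : V →ₗ[ℂ] V) v) = (s : ℂ) ^ w none * b i v := by
      rintro (_ | i | j) s v
      · exact hw _ s v
      · rw [hw, hz]
      · rw [hw, hu]
    obtain ⟨U, hU, hxU, hiso⟩ := h.isolated
    have hev : ∀ᶠ y in nhdsOn Z x, y = x := by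
      let _ := zariski V
      refine mem_nhdsWithin.2 ⟨U, hU, hxU, ?_⟩
      rintro y ⟨hyU, hyZ⟩
      exact hiso y ⟨hyZ, hyU⟩ fun s => smul_eq_of_weights hall s y
    refine hb.zGerm_notMem hx i₀ ?_
    have : hb.zGerm i₀ = 0 := by
      refine (linearGerm_eq_zero_iff Z hb.chart hZ hx).2 ?_
      refine form_vanishes_of_eventually hZ hx _ ?_
      filter_upwards [hev] with y hy
      rw [hy]
      exact hb.origin _
    rw [this]
    exact zero_mem _
  · intro i j hij
    have hij' : (2 : ℂ) ^ (a * i) = 2 ^ (a * j) := by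
      simp only [zpow_mul, zpow_natCast, ← hca]
      exact hij
    have := mul_left_cancel₀ h0 (two_zpow_injective hij')
    exact_mod_cast this

/-- The germs `u_j / t` are homogeneous polynomials in the `z_i / t`. -/
theorem IsAdapted.exists_uGerm_eq [FiniteDimensional ℂ V] (hb : IsAdapted Z x ρ b)
    (h : IsEulerType Z x ρ) (hZ : IsProjectiveVariety Z) (hn : IsNondegenerate Z) (j : Fin m) :
    ∃ (d : ℕ) (P : MvPolynomial (Fin n) ℂ), 2 ≤ d ∧ P.IsHomogeneous d ∧
      hb.uGerm j = MvPolynomial.aeval hb.zGerm P := by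
  have hx := h.nonsingular.1
  obtain ⟨q, hS, hq⟩ := hb.exists_scales h hZ hn
  obtain ⟨w, hw⟩ := hb.eigen none
  obtain ⟨w', hw'⟩ := hb.eigen (some (Sum.inr j))
  have hu : h.doubling (hb.uGerm j) = _ := h.doubling_linearGerm hb.chart hw hw'
  by_cases hd : ∃ d ≥ 2, (2 : ℂ) ^ (w' - w) = q ^ d
  · obtain ⟨d, hd, he⟩ := hd
    rw [he] at hu
    obtain ⟨P, hP, hPu⟩ := hS.eq_aeval (hb.spans hx) h.nonsingular hd hq (hb.tangent j) hu
    exact ⟨d, P, hd, hP, hPu⟩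
  · push Not at hd
    -- No admissible power of `q` matches, so the germ is zero. The degree `2` is a default, as the
    -- zero polynomial is homogeneous of every degree.
    refine ⟨2, 0, le_rfl, MvPolynomial.isHomogeneous_zero _ _ _, ?_⟩
    rw [map_zero]
    exact hS.eq_zero (hb.spans hx) h.nonsingular hd (hb.tangent j) hu

end Adapted

/-! ### Graphs -/

section Graph

variable {Z : Set (ℙ ℂ V)} {x : ℙ ℂ V} {ρ : ℂˣ →* LinearMap.GeneralLinearGroup ℂ V}
  {n m : ℕ} {b : Module.Basis (CoordIdx n m) ℂ (Module.Dual ℂ V)}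

/-- The parametrization of the graph of `h`: the values of linear forms at `(1, z, h z)` as
polynomials in `z`. -/
def graphMap (b : Module.Basis (CoordIdx n m) ℂ (Module.Dual ℂ V))
    (h : Fin m → MvPolynomial (Fin n) ℂ) : Module.Dual ℂ V →ₗ[ℂ] MvPolynomial (Fin n) ℂ :=
  b.constr ℂ fun i => i.elim 1 (Sum.elim MvPolynomial.X h)

variable {h : Fin m → MvPolynomial (Fin n) ℂ}

theorem graphMap_t : graphMap b h (b none) = 1 := b.constr_basis _ _ _

theorem graphMap_z (i : Fin n) : graphMap b h (b (some (Sum.inl i))) = MvPolynomial.X i :=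
  b.constr_basis _ _ _

theorem graphMap_u (j : Fin m) : graphMap b h (b (some (Sum.inr j))) = h j :=
  b.constr_basis _ _ _

variable (hb : IsAdapted Z x ρ b) (hu : ∀ j, hb.uGerm j = MvPolynomial.aeval hb.zGerm (h j))

include hu in
theorem linearGerm_eq_aeval (l : Module.Dual ℂ V) :
    linearGerm Z x (b none) hb.chart l = MvPolynomial.aeval hb.zGerm (graphMap b h l) := by
  have e : linearGerm Z x (b none) hb.chart =
      (MvPolynomial.aeval hb.zGerm).toLinearMap ∘ₗ graphMap b h := by
    refine b.ext ?_
    rintro (_ | i | j)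
    · simp [graphMap_t, linearGerm_self]
    · simp only [LinearMap.comp_apply, graphMap_z, AlgHom.toLinearMap_apply, MvPolynomial.aeval_X]
      rfl
    · simp only [LinearMap.comp_apply, graphMap_u, AlgHom.toLinearMap_apply]
      exact hu j
  exact congrArg (fun F => F l) e

include hu in
theorem chartGerm_eq_aeval (f : MvPolynomial (Module.Dual ℂ V) ℂ) :
    chartGerm Z hb.chart f =
      MvPolynomial.aeval hb.zGerm (MvPolynomial.aeval (graphMap b h) f) := by
  rw [← AlgHom.comp_apply, MvPolynomial.comp_aeval, chartGerm]
  congr 2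
  funext l
  exact linearGerm_eq_aeval hb hu l

include hu in
-- With the `u_j / t` expressed through the `z_i / t`, the latter suffice to write all germs as
-- fractions; this is the input for algebraic independence.
theorem exists_mul_aeval_eq (hx : x ∈ Z) (φ : localRing Z x) :
    ∃ F G : MvPolynomial (Fin n) ℂ, MvPolynomial.eval 0 G ≠ 0 ∧
      φ * MvPolynomial.aeval hb.zGerm G = MvPolynomial.aeval hb.zGerm F := by
  obtain ⟨f, g, hg, hφ⟩ := exists_mul_chartGerm_eq Z hb.chart φ
  rw [chartGerm_eq_aeval hb hu, chartGerm_eq_aeval hb hu] at hφ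
  refine ⟨_, _, ?_, hφ⟩
  rwa [← evalAt_aeval (hb.spans hx) hx, ← chartGerm_eq_aeval hb hu, evalAt_chartGerm]

include hu in
theorem IsAdapted.aeval_injective (hx : IsNonsingularAt Z x) : Function.Injective
    (MvPolynomial.aeval hb.zGerm : MvPolynomial (Fin n) ℂ →ₐ[ℂ] localRing Z x) :=
  (hb.spans hx.1).aeval_injective hx hb.finrank_eq (exists_mul_aeval_eq hb hu hx.1)

include hu in
-- A form killed by `graphMap` has zero germ, hence vanishes on `Z`. Linear independence of the
-- `h_j` is the restriction of this to the `u_j`.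
theorem graphMap_injective (hZ : IsProjectiveVariety Z) (hx : x ∈ Z) (hn : IsNondegenerate Z) :
    Function.Injective (graphMap b h) := by
  rw [injective_iff_map_eq_zero]
  intro l hl
  refine linearGerm_injective Z hb.chart hZ hx hn ?_
  rw [linearGerm_eq_aeval hb hu, hl, map_zero, map_zero]

include hu in
theorem graph_of_mem (hZ : IsProjectiveVariety Z) (hx : x ∈ Z) {d : Fin m → ℕ}
    (hd : ∀ j, 1 ≤ d j ∧ (h j).IsHomogeneous (d j)) {y : ℙ ℂ V} (hy : b none y.rep ≠ 0)
    (hyZ : y ∈ Z) (j : Fin m) : b (some (Sum.inr j)) y.rep / b none y.rep =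
      MvPolynomial.eval (fun i => b (some (Sum.inl i)) y.rep / b none y.rep) (h j) := by
  -- The homogenized equation `u_j t^(d_j - 1) - h_j(z)`; `1 ≤ d_j` makes the truncated exponent
  -- correct.
  let f : MvPolynomial (Module.Dual ℂ V) ℂ :=
    MvPolynomial.X (b (some (Sum.inr j))) * MvPolynomial.X (b none) ^ (d j - 1) -
      MvPolynomial.rename (fun i => b (some (Sum.inl i))) (h j)
  have hf : f.IsHomogeneous (d j) := by
    refine MvPolynomial.IsHomogeneous.sub ?_ (hd j).2.rename_isHomogeneous
    have h1 := (MvPolynomial.isHomogeneous_X ℂ (b (some (Sum.inr j)))).mul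
      (MvPolynomial.isHomogeneous_X_pow (R := ℂ) (b none) (d j - 1))
    rwa [Nat.add_sub_cancel' (hd j).1] at h1
  have h0 : chartGerm Z hb.chart f = 0 := by
    simp only [chartGerm, f, map_sub, map_mul, map_pow, MvPolynomial.aeval_X, linearGerm_self,
      one_pow, mul_one, MvPolynomial.aeval_rename]
    rw [sub_eq_zero]
    exact hu j
  have h1 := (chartGerm_eq_zero_iff Z hb.chart hZ hx hf).1 h0 y hyZ
  have h2 : polyVal f ((b none y.rep)⁻¹ • y.rep) = 0 := by
    rw [polyVal_smul hf, h1, mul_zero]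
  simp only [polyVal, f, map_sub, map_mul, map_pow, MvPolynomial.eval_X, MvPolynomial.eval_rename,
    map_smul, smul_eq_mul, inv_mul_cancel₀ hy, one_pow, mul_one, sub_eq_zero] at h2
  rw [div_eq_inv_mul, h2]
  congr 2
  funext i
  simp [div_eq_inv_mul]

theorem eval_graphMap {y : ℙ ℂ V} (hy : b none y.rep ≠ 0)
    (hg : ∀ j, b (some (Sum.inr j)) y.rep / b none y.rep =
      MvPolynomial.eval (fun i => b (some (Sum.inl i)) y.rep / b none y.rep) (h j))
    (l : Module.Dual ℂ V) :
    MvPolynomial.eval (fun i => b (some (Sum.inl i)) y.rep / b none y.rep) (graphMap b h l) =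
      l y.rep / b none y.rep := by
  have e : (MvPolynomial.aeval (R := ℂ)
      fun i => b (some (Sum.inl i)) y.rep / b none y.rep).toLinearMap ∘ₗ graphMap b h =
      (b none y.rep)⁻¹ • Module.Dual.eval ℂ V y.rep := by
    refine b.ext ?_
    rintro (_ | i | j)
    · simp [graphMap_t, hy]
    · simp [graphMap_z, div_eq_inv_mul]
    · simp only [LinearMap.comp_apply, graphMap_u, AlgHom.toLinearMap_apply]
      rw [MvPolynomial.aeval_eq_eval]
      refine (hg j).symm.trans ?_
      simp [div_eq_inv_mul]
  have := congrArg (fun F => F l) e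
  simp only [LinearMap.comp_apply, AlgHom.toLinearMap_apply, MvPolynomial.aeval_eq_eval] at this
  refine this.trans ?_
  simp [div_eq_inv_mul]

include hu in
-- A homogeneous `f` vanishing on `Z` restricts to the graph as a polynomial in the `z_i` whose germ
-- is zero. Algebraic independence makes this polynomial zero, so `f` vanishes at every point of the
-- graph, and `Z` is closed.
theorem mem_of_graph (hZ : IsProjectiveVariety Z) (hx : IsNonsingularAt Z x) {y : ℙ ℂ V}
    (hy : b none y.rep ≠ 0) (hg : ∀ j, b (some (Sum.inr j)) y.rep / b none y.rep =
      MvPolynomial.eval (fun i => b (some (Sum.inl i)) y.rep / b none y.rep) (h j)) : y ∈ Z := by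
  refine mem_of_isClosed hZ.1 fun k f hf hfZ => ?_
  have h0 := (chartGerm_eq_zero_iff Z hb.chart hZ hx.1 hf).2 hfZ
  rw [chartGerm_eq_aeval hb hu] at h0
  have h1 := hb.aeval_injective hu hx (h0.trans (map_zero _).symm)
  have h2 := congrArg
    (MvPolynomial.aeval (R := ℂ) fun i => b (some (Sum.inl i)) y.rep / b none y.rep) h1
  rw [← AlgHom.comp_apply, MvPolynomial.comp_aeval, map_zero] at h2
  have h3 : polyVal f ((b none y.rep)⁻¹ • y.rep) = 0 := by
    rw [← h2, MvPolynomial.aeval_eq_eval, polyVal]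
    congr 2
    funext l
    rw [MvPolynomial.aeval_eq_eval]
    refine Eq.trans ?_ (eval_graphMap hy hg l).symm
    simp [div_eq_inv_mul]
  rw [polyVal_smul hf, mul_eq_zero] at h3
  exact h3.resolve_left (pow_ne_zero _ (inv_ne_zero hy))

theorem IsAdapted.isHomogeneousGraph [FiniteDimensional ℂ V] (hb : IsAdapted Z x ρ b)
    (hρ : IsEulerType Z x ρ) (hZ : IsProjectiveVariety Z) (hn : IsNondegenerate Z) :
    IsHomogeneousGraph Z b := by
  choose d h hd hh hu using hb.exists_uGerm_eq hρ hZ hn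
  have hx := hρ.nonsingular
  refine ⟨d, h, fun j => ⟨hd j, hh j⟩, ?_, fun y hy => ⟨fun hyZ => ?_, mem_of_graph hb hu hZ hx hy⟩⟩
  · have hli : LinearIndependent ℂ fun j => b (some (Sum.inr j)) :=
      b.linearIndependent.comp (fun j => some (Sum.inr j)) fun i j hij => by simpa using hij
    have := hli.map' (graphMap b h) (LinearMap.ker_eq_bot.2 (graphMap_injective hb hu hZ hx.1 hn))
    have e : graphMap b h ∘ (fun j => b (some (Sum.inr j))) = h := funext fun j => graphMap_u j
    rwa [e] at this
  · exact graph_of_mem hb hu hZ hx.1 (fun j => ⟨one_le_two.trans (hd j), hh j⟩) hy hyZ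

end Graph

/-! ### Eigenforms of an algebraic action of the multiplicative group -/

section Eigenforms

variable (ρ : ℂˣ →* LinearMap.GeneralLinearGroup ℂ V)

/-- `l` is an eigenvector of weight `w` for `ρ`. -/
def IsEigenform (w : ℤ) (l : Module.Dual ℂ V) : Prop :=
  ∀ (s : ℂˣ) (v : V), l ((ρ s : V →ₗ[ℂ] V) v) = (s : ℂ) ^ w * l v

/-- The set of all eigenvectors for `ρ` in the dual space. -/
def eigenforms : Set (Module.Dual ℂ V) := {l | ∃ w, IsEigenform ρ w l}

theorem exists_eval₂_eq_sum (p : LaurentPolynomial ℂ) : ∃ c : ℤ →₀ ℂ,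
    ∀ s : ℂˣ, LaurentPolynomial.eval₂ (RingHom.id ℂ) s p = c.sum fun w a => a * (s : ℂ) ^ w := by
  induction p using LaurentPolynomial.induction_on' with
  | add p q hp hq =>
    obtain ⟨c, hc⟩ := hp
    obtain ⟨d, hd⟩ := hq
    refine ⟨c + d, fun s => ?_⟩
    rw [map_add, hc, hd, Finsupp.sum_add_index']
    · simp
    · simp [add_mul]
  | C_mul_T w a =>
    refine ⟨Finsupp.single w a, fun s => ?_⟩
    rw [Finsupp.sum_single_index (by simp), map_mul, LaurentPolynomial.eval₂_C,
      LaurentPolynomial.eval₂_T, Units.val_zpow_eq_zpow_val, RingHom.id_apply]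

/-- Linear independence of the distinct characters `s ↦ s^w`. -/
theorem eq_zero_of_sum_zpow {S : Finset ℤ} {a : ℤ → ℂ}
    (h : ∀ s : ℂˣ, ∑ w ∈ S, a w * (s : ℂ) ^ w = 0) : ∀ w ∈ S, a w = 0 := by
  let f : ℤ → ℂˣ →* ℂ := fun w => (Units.coeHom ℂ).comp (zpowGroupHom w)
  have hf : ∀ w s, f w s = (s : ℂ) ^ w := fun w s => by simp [f]
  have hinj : Function.Injective f := fun i j hij => by
    have := congrArg (fun g => g unitTwo) hij
    simp only [hf] at this
    exact two_zpow_injective this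
  have hli := (linearIndependent_monoidHom ℂˣ ℂ).comp f hinj
  rw [linearIndependent_iff'] at hli
  refine hli S a (funext fun s => ?_)
  simpa [hf] using h s

variable {ρ}

/-- Every linear form is a sum of eigenvectors. -/
theorem exists_eigen_decomposition [FiniteDimensional ℂ V] (hρ : IsAlgebraicHom ρ)
    (l : Module.Dual ℂ V) : ∃ (S : Finset ℤ) (c : ℤ → Module.Dual ℂ V),
      (∀ w ∈ S, IsEigenform ρ w (c w)) ∧ l = ∑ w ∈ S, c w := by
  classical
  let e := Module.finBasis ℂ V
  choose p hp using fun i => hρ l (e i)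
  choose a ha using fun i => exists_eval₂_eq_sum (p i)
  let S : Finset ℤ := Finset.univ.biUnion fun i => (a i).support
  -- `c w` is the coefficient of `s^w` in the Laurent polynomial `s ↦ l ∘ ρ(s)`.
  let c : ℤ → Module.Dual ℂ V := fun w => ∑ i, a i w • e.coord i
  have hce : ∀ w i, c w (e i) = a i w := fun w i => by
    simp [c, Finsupp.single_apply]
  have key : ∀ (s : ℂˣ) (v : V), l ((ρ s : V →ₗ[ℂ] V) v) = ∑ w ∈ S, c w v * (s : ℂ) ^ w := by
    intro s
    have h : l ∘ₗ (ρ s : V →ₗ[ℂ] V) = ∑ w ∈ S, (s : ℂ) ^ w • c w := by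
      refine e.ext fun i => ?_
      rw [LinearMap.comp_apply, hp, ha, Finsupp.sum_of_support_subset (s := S)]
      · simp [hce, mul_comm]
      · exact Finset.subset_biUnion_of_mem (fun i => (a i).support) (Finset.mem_univ i)
      · simp
    intro v
    have := congrArg (fun f => f v) h
    simpa [mul_comm] using this
  refine ⟨S, c, fun w hw r v => ?_, ?_⟩
  -- Compare coefficients of `s^w` in `l (ρ(s) ρ(r) v) = l (ρ(sr) v)`. The decomposition of `l`
  -- itself is the case `s = 1`.
  · have h : ∀ s : ℂˣ, ∑ w ∈ S,
        (c w ((ρ r : V →ₗ[ℂ] V) v) - (r : ℂ) ^ w * c w v) * (s : ℂ) ^ w = 0 := by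
      intro s
      have h1 := key s ((ρ r : V →ₗ[ℂ] V) v)
      have h2 := key (s * r) v
      rw [map_mul] at h2
      have h3 := h1.symm.trans h2
      simp only [sub_mul, Finset.sum_sub_distrib]
      rw [h3, sub_eq_zero]
      refine Finset.sum_congr rfl fun w _ => ?_
      rw [Units.val_mul, mul_zpow]
      ring
    exact sub_eq_zero.1 (eq_zero_of_sum_zpow h w hw)
  · ext v
    have := key 1 v
    simpa using this

/-- Used for weight components: eigenvalue arguments handle all weights but one, and the sum takes
care of the last. -/
theorem mem_of_sum_mem {M : Type*} [AddCommGroup M] (N : AddSubgroup M) {S : Finset ℤ} {f : ℤ → M}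
    (w₀ : ℤ) (h : ∀ w ∈ S, w ≠ w₀ → f w ∈ N) (hsum : ∑ w ∈ S, f w ∈ N) : ∀ w ∈ S, f w ∈ N := by
  intro w hw
  rcases eq_or_ne w w₀ with rfl | hne
  · rw [← Finset.add_sum_erase S f hw] at hsum
    exact (AddSubgroup.add_mem_cancel_right N
      (sum_mem fun v hv => h v (Finset.mem_of_mem_erase hv) (Finset.ne_of_mem_erase hv))).1 hsum
  · exact h w hw hne

end Eigenforms

/-! ### Existence of adapted coordinates -/

section Existence

variable {Z : Set (ℙ ℂ V)} {x : ℙ ℂ V} {ρ : ℂˣ →* LinearMap.GeneralLinearGroup ℂ V}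

/-- The line `x` is an eigenline of `ρ(2)`, and any eigenform that does not vanish on it has the
same eigenvalue. -/
theorem weight_eq_of_fixed (hfix : ∀ s : ℂˣ, ρ s • x = x) {l l' : Module.Dual ℂ V} {w w' : ℤ}
    (hl : IsEigenform ρ w l) (hl' : IsEigenform ρ w' l') (h : l x.rep ≠ 0) (h' : l' x.rep ≠ 0) :
    w = w' := by
  obtain ⟨a, ha⟩ := smul_rep (ρ unitTwo) x
  rw [hfix] at ha
  have e : ∀ {w : ℤ} {l : Module.Dual ℂ V}, IsEigenform ρ w l → l x.rep ≠ 0 →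
      (a : ℂ) * 2 ^ w = 1 := fun {w l} hl h => by
    have h1 := congrArg l ha
    rw [map_smul, hl, smul_eq_mul, ← mul_assoc] at h1
    exact mul_right_cancel₀ h (h1.symm.trans (one_mul _).symm)
  exact two_zpow_injective (mul_left_cancel₀ a.ne_zero ((e hl h).trans (e hl' h').symm))

theorem exists_eigenform_ne [FiniteDimensional ℂ V] (hρ : IsAlgebraicHom ρ) (x : ℙ ℂ V) :
    ∃ t ∈ eigenforms ρ, t x.rep ≠ 0 := by
  obtain ⟨S, c, hc, h⟩ := exists_eigen_decomposition hρ (trivForm x)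
  by_contra! hall
  refine trivForm_ne x ?_
  rw [h, LinearMap.sum_apply]
  exact Finset.sum_eq_zero fun w hw => hall _ ⟨w, hc w hw⟩

/-- The space of linear forms that vanish at `x`. -/
def vanishingForms (x : ℙ ℂ V) : Submodule ℂ (Module.Dual ℂ V) :=
  LinearMap.ker (Module.Dual.eval ℂ V x.rep)

variable (Z) in
/-- The space of linear forms that vanish on the embedded tangent space at `x`. -/
def conormalForms {t : Module.Dual ℂ V} (ht : t x.rep ≠ 0) : Submodule ℂ (Module.Dual ℂ V) :=
  ((maxIdeal Z x ^ 2).restrictScalars ℂ).comap (linearGerm Z x t ht)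

theorem eigen_decomposition_vanishing (h : IsEulerType Z x ρ) {t : Module.Dual ℂ V} {wt : ℤ}
    (hwt : IsEigenform ρ wt t) (ht : t x.rep ≠ 0) {S : Finset ℤ} {c : ℤ → Module.Dual ℂ V}
    (hc : ∀ w ∈ S, IsEigenform ρ w (c w)) (hl : ∑ w ∈ S, c w ∈ vanishingForms x) :
    ∀ w ∈ S, c w ∈ vanishingForms x := by
  refine mem_of_sum_mem (vanishingForms x).toAddSubgroup wt (fun w hw hne => ?_) hl
  change c w x.rep = 0
  by_contra hcw
  exact hne (weight_eq_of_fixed h.fixed (hc w hw) hwt hcw ht)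

theorem vanishingForms_le_span [FiniteDimensional ℂ V] (h : IsEulerType Z x ρ)
    {t : Module.Dual ℂ V} {wt : ℤ} (hwt : IsEigenform ρ wt t) (ht : t x.rep ≠ 0) :
    vanishingForms x ≤ Submodule.span ℂ (eigenforms ρ ∩ vanishingForms x) := by
  intro l hl
  obtain ⟨S, c, hc, rfl⟩ := exists_eigen_decomposition h.algebraic l
  have hK := eigen_decomposition_vanishing h hwt ht hc hl
  exact sum_mem fun w hw => Submodule.subset_span ⟨⟨w, hc w hw⟩, hK w hw⟩

theorem conormalForms_le_vanishingForms (hx : x ∈ Z) {t : Module.Dual ℂ V} (ht : t x.rep ≠ 0) :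
    conormalForms Z ht ≤ vanishingForms x := fun _ hl =>
  (linearGerm_mem_maxIdeal Z ht hx).1 (Ideal.pow_le_self two_ne_zero hl)

/-- `ρ(2)` acts on `𝔪 / 𝔪²` by one scalar, so a weight component with another eigenvalue has zero
differential. At most one weight remains, and its component is conormal because the whole sum is. -/
theorem conormalForms_le_span [FiniteDimensional ℂ V] (h : IsEulerType Z x ρ)
    {t : Module.Dual ℂ V} {wt : ℤ} (hwt : IsEigenform ρ wt t) (ht : t x.rep ≠ 0) :
    conormalForms Z ht ≤ Submodule.span ℂ (eigenforms ρ ∩ conormalForms Z ht) := by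
  intro l hl
  have hx := h.nonsingular.1
  obtain ⟨S, c, hc, rfl⟩ := exists_eigen_decomposition h.algebraic l
  have hK := eigen_decomposition_vanishing h hwt ht hc (conormalForms_le_vanishingForms hx ht hl)
  obtain ⟨γ, hγ⟩ := h.scalar unitTwo
  have hw : ∀ w ∈ S, (2 : ℂ) ^ (w - wt) ≠ γ → c w ∈ conormalForms Z ht := by
    intro w hw hne
    have h1 := hγ.pullback_sub_mem _ (h.preserves _) (h.fixed _)
      ((linearGerm_mem_maxIdeal Z ht hx).2 (hK w hw))
    change h.doubling (linearGerm Z x t ht (c w)) - γ • linearGerm Z x t ht (c w) ∈ _ at h1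
    rw [h.doubling_linearGerm ht hwt (hc w hw), ← sub_smul] at h1
    have h3 := smul_mem_pow ((2 : ℂ) ^ (w - wt) - γ)⁻¹ h1
    rwa [smul_smul, inv_mul_cancel₀ (sub_ne_zero.2 hne), one_smul] at h3
  have hall : ∀ w ∈ S, c w ∈ conormalForms Z ht := by
    by_cases hex : ∃ w₀ : ℤ, (2 : ℂ) ^ (w₀ - wt) = γ
    · obtain ⟨w₀, hw₀⟩ := hex
      refine mem_of_sum_mem (conormalForms Z ht).toAddSubgroup w₀ (fun w hwS hne => hw w hwS ?_) hl
      intro he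
      have := two_zpow_injective (he.trans hw₀.symm)
      omega
    · exact fun w hwS => hw w hwS fun he => hex ⟨w, he⟩
  exact sum_mem fun w hwS => Submodule.subset_span ⟨⟨w, hc w hwS⟩, hall w hwS⟩

/-- The differential at `x` of a linear form that vanishes at `x`. -/
def differential (hx : x ∈ Z) {t : Module.Dual ℂ V} (ht : t x.rep ≠ 0) :
    vanishingForms x →ₗ[ℂ] Cotangent Z x where
  toFun l := (maxIdeal Z x).toCotangent
    ⟨linearGerm Z x t ht l, (linearGerm_mem_maxIdeal Z ht hx).2 l.2⟩
  map_add' l l' := by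
    rw [← map_add]
    congr 1
    exact Subtype.ext (map_add _ _ _)
  map_smul' c l := by
    rw [RingHom.id_apply, ← smul_toCotangent]
    congr 1
    exact Subtype.ext (map_smul _ _ _)

theorem differential_eq_zero (hx : x ∈ Z) {t : Module.Dual ℂ V} (ht : t x.rep ≠ 0)
    {l : vanishingForms x} : differential hx ht l = 0 ↔ (l : Module.Dual ℂ V) ∈ conormalForms Z ht :=
  Ideal.toCotangent_eq_zero _ _

theorem differential_surjective (hx : x ∈ Z) {t : Module.Dual ℂ V} (ht : t x.rep ≠ 0) :
    Function.Surjective (differential (Z := Z) hx ht) := by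
  intro a
  obtain ⟨⟨φ, hφ⟩, rfl⟩ := Ideal.toCotangent_surjective _ a
  obtain ⟨l, hl, h⟩ := exists_sub_linearGerm_mem ht hx hφ
  exact ⟨⟨l, hl⟩, ((Ideal.toCotangent_eq _).2 h).symm⟩

/-- A spanning set of a finite-dimensional space contains a basis. -/
theorem exists_basis_mem {M : Type*} [AddCommGroup M] [Module ℂ M] [FiniteDimensional ℂ M]
    {s : Set M} (hs : Submodule.span ℂ s = ⊤) :
    ∃ (n : ℕ) (e : Module.Basis (Fin n) ℂ M), ∀ i, e i ∈ s := by
  obtain ⟨B, hBs, hspan, hli⟩ := exists_linearIndependent ℂ s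
  have : Finite B := hli.finite
  let e₀ : Module.Basis B ℂ M := Module.Basis.mk hli (by simp [hspan, hs])
  refine ⟨Nat.card B, e₀.reindex (Finite.equivFin B), fun i => ?_⟩
  rw [Module.Basis.reindex_apply, Module.Basis.mk_apply]
  exact hBs (Subtype.coe_prop _)

theorem exists_basis_of_le_span [FiniteDimensional ℂ V] {W : Submodule ℂ (Module.Dual ℂ V)}
    {s : Set (Module.Dual ℂ V)} (h : W ≤ Submodule.span ℂ (s ∩ W)) :
    ∃ (n : ℕ) (e : Module.Basis (Fin n) ℂ W), ∀ i, (e i : Module.Dual ℂ V) ∈ s := by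
  refine exists_basis_mem (s := {l : W | (l : Module.Dual ℂ V) ∈ s}) ?_
  rw [eq_top_iff, ← Submodule.map_le_map_iff_of_injective W.injective_subtype, Submodule.map_top,
    Submodule.range_subtype, Submodule.map_span]
  refine h.trans (Submodule.span_mono ?_)
  rintro l ⟨hl, hlW⟩
  exact ⟨⟨l, hlW⟩, hl, rfl⟩

/-- Eigenforms are chosen along the filtration `V^* ⊇ {forms vanishing at x} ⊇ {conormal forms}`:
`t` does not vanish at `x`, the differentials of the `z_i` form a basis of `𝔪 / 𝔪²`, and the `u_j`
form a basis of the conormal space. Independence and spanning are checked step by step along this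
filtration. -/
theorem IsEulerType.exists_isAdapted [FiniteDimensional ℂ V] (h : IsEulerType Z x ρ) :
    ∃ (n m : ℕ) (b : Module.Basis (CoordIdx n m) ℂ (Module.Dual ℂ V)), IsAdapted Z x ρ b := by
  have hx := h.nonsingular.1
  obtain ⟨t, ⟨wt, hwt⟩, ht⟩ := exists_eigenform_ne h.algebraic x
  obtain ⟨m, u, hu⟩ := exists_basis_of_le_span (conormalForms_le_span h hwt ht)
  let δ := differential (Z := Z) hx ht
  have hδ : Function.Surjective δ := differential_surjective hx ht
  have : FiniteDimensional ℂ (Cotangent Z x) := Module.Finite.of_surjective δ hδ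
  obtain ⟨n₀, e₀, he₀⟩ := exists_basis_of_le_span (vanishingForms_le_span h hwt ht)
  obtain ⟨n, e, he⟩ := exists_basis_mem (s := Set.range (δ ∘ e₀)) (by
    rw [Set.range_comp, ← Submodule.map_span, e₀.span_eq, Submodule.map_top,
      LinearMap.range_eq_top.2 hδ])
  choose i hi using he
  let z : Fin n → vanishingForms x := fun k => e₀ (i k)
  have hz : ∀ k, δ (z k) = e k := hi
  let f : CoordIdx n m → Module.Dual ℂ V := fun k =>
    k.elim t (Sum.elim (fun k => (z k : Module.Dual ℂ V)) fun j => (u j : Module.Dual ℂ V))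
  have hli : LinearIndependent ℂ f := by
    rw [Fintype.linearIndependent_iff]
    intro g hg
    rw [Fintype.sum_option, Fintype.sum_sum_type] at hg
    have hu' : ∑ j, g (some (Sum.inr j)) • (u j : Module.Dual ℂ V) ∈ conormalForms Z ht :=
      sum_mem fun j _ => Submodule.smul_mem _ _ (u j).2
    have hz' : ∑ k, g (some (Sum.inl k)) • (z k : Module.Dual ℂ V) ∈ vanishingForms x :=
      sum_mem fun k _ => Submodule.smul_mem _ _ (z k).2
    change g none • t + (∑ k, g (some (Sum.inl k)) • (z k : Module.Dual ℂ V) +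
      ∑ j, g (some (Sum.inr j)) • (u j : Module.Dual ℂ V)) = 0 at hg
    have h0 : g none = 0 := by
      have h1 : g none • t ∈ vanishingForms x := by
        rw [eq_neg_of_add_eq_zero_left hg]
        exact neg_mem (add_mem hz' (conormalForms_le_vanishingForms hx ht hu'))
      exact (mul_eq_zero.1 (show g none * t x.rep = 0 from h1)).resolve_right ht
    rw [h0, zero_smul, zero_add] at hg
    have h1 : ∀ k, g (some (Sum.inl k)) = 0 := by
      refine Fintype.linearIndependent_iff.1 e.linearIndependent _ ?_
      have h2 : δ (∑ k, g (some (Sum.inl k)) • z k) = 0 := by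
        rw [differential_eq_zero]
        simp only [Submodule.coe_sum, Submodule.coe_smul]
        rw [eq_neg_of_add_eq_zero_left hg]
        exact neg_mem hu'
      simpa only [map_sum, map_smul, hz] using h2
    simp only [h1, zero_smul, Finset.sum_const_zero, zero_add] at hg
    have h3 : ∀ j, g (some (Sum.inr j)) = 0 := by
      refine Fintype.linearIndependent_iff.1 u.linearIndependent _ (Subtype.ext ?_)
      rw [Submodule.coe_sum]
      exact hg
    rintro (_ | k | j)
    exacts [h0, h1 k, h3 j]
  have hsub : ∀ k, f k ∈ Submodule.span ℂ (Set.range f) := fun k => Submodule.subset_span ⟨k, rfl⟩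
  have hspan : ⊤ ≤ Submodule.span ℂ (Set.range f) := by
    rintro l -
    have hl₁ : l - (l x.rep / t x.rep) • t ∈ vanishingForms x := by
      change l x.rep - l x.rep / t x.rep * t x.rep = 0
      rw [div_mul_cancel₀ _ ht, sub_self]
    set l₁ : vanishingForms x := ⟨_, hl₁⟩ with hl₁def
    set l₂ : vanishingForms x := l₁ - ∑ k, e.repr (δ l₁) k • z k with hl₂def
    have hl₂ : (l₂ : Module.Dual ℂ V) ∈ conormalForms Z ht := by
      rw [← differential_eq_zero hx ht]
      change δ l₂ = 0
      simp only [hl₂def, map_sub, map_sum, map_smul, hz]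
      rw [e.sum_repr, sub_self]
    have hl₃ : (l₂ : Module.Dual ℂ V) ∈ Submodule.span ℂ (Set.range f) := by
      have h4 := congrArg (fun a : conormalForms Z ht => (a : Module.Dual ℂ V))
        (u.sum_repr ⟨l₂, hl₂⟩)
      simp only [Submodule.coe_sum, Submodule.coe_smul] at h4
      rw [← h4]
      exact sum_mem fun j _ => Submodule.smul_mem _ _ (hsub (some (Sum.inr j)))
    have h5 : l = (l₂ : Module.Dual ℂ V) + ∑ k, e.repr (δ l₁) k • (z k : Module.Dual ℂ V) +
        (l x.rep / t x.rep) • t := by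
      simp only [hl₂def, Submodule.coe_sub, Submodule.coe_sum, Submodule.coe_smul, sub_add_cancel,
        hl₁def]
    rw [h5]
    exact add_mem (add_mem hl₃ (sum_mem fun k _ =>
      Submodule.smul_mem _ _ (hsub (some (Sum.inl k))))) (Submodule.smul_mem _ _ (hsub none))
  have hb : ∀ k, Module.Basis.mk hli hspan k = f k := fun k => Module.Basis.mk_apply _ _ _
  have hn : Module.Basis.mk hli hspan none = t := hb none
  refine ⟨n, m, Module.Basis.mk hli hspan, ?_, ?_, ?_, ?_, ?_⟩
  · intro k
    rw [hb]
    rcases k with _ | k | j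
    · exact ⟨wt, hwt⟩
    · exact he₀ (i k)
    · exact hu j
  · rwa [hn]
  · rintro (k | j)
    · rw [hb]
      exact (z k).2
    · rw [hb]
      exact conormalForms_le_vanishingForms hx ht (u j).2
  · rw [Module.finrank_eq_card_basis e, Fintype.card_fin]
  · intro j
    simp only [hb]
    exact (u j).2

end Existence

/-! ### Leading terms in local parameters -/

section Leading

variable {Z : Set (ℙ ℂ V)} {x : ℙ ℂ V} {n : ℕ} {z : Fin n → localRing Z x}

theorem mem_idealOfVars_iff {σ : Type*} {p : MvPolynomial σ ℂ} :
    p ∈ MvPolynomial.idealOfVars σ ℂ ↔ MvPolynomial.eval 0 p = 0 := by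
  have h := MvPolynomial.mem_pow_idealOfVars_iff' 1 p
  rw [pow_one] at h
  rw [h, MvPolynomial.eval_zero, MvPolynomial.constantCoeff_eq]
  constructor
  · intro h
    exact h 0 (by simp)
  · intro h d hd
    have h0 : d = 0 := by
      rw [← Finsupp.degree_eq_zero_iff]
      omega
    rw [h0, h]

/-- With `c = q(0)` one has `c p = p q - p (q - c)`, and `q - c` lies in the ideal; so the power
containing `p` can be raised one step at a time up to `k`. -/
theorem mem_pow_idealOfVars_of_mul {σ : Type*} {p q : MvPolynomial σ ℂ}
    (hq : MvPolynomial.eval 0 q ≠ 0) {k : ℕ} (h : p * q ∈ MvPolynomial.idealOfVars σ ℂ ^ k) :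
    p ∈ MvPolynomial.idealOfVars σ ℂ ^ k := by
  set c := MvPolynomial.eval 0 q
  have hj : q - MvPolynomial.C c ∈ MvPolynomial.idealOfVars σ ℂ := by
    rw [mem_idealOfVars_iff]
    simp [c]
  have key : ∀ i ≤ k, p ∈ MvPolynomial.idealOfVars σ ℂ ^ i := by
    intro i
    induction i with
    | zero => simp
    | succ i ih =>
      intro hi
      have h1 : p * (q - MvPolynomial.C c) ∈ MvPolynomial.idealOfVars σ ℂ ^ (i + 1) := by
        rw [pow_succ]
        exact Ideal.mul_mem_mul (ih (by omega)) hj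
      have h2 := sub_mem (Ideal.pow_le_pow_right hi h) h1
      have h3 := Ideal.mul_mem_left _ (MvPolynomial.C c⁻¹) h2
      rwa [← mul_sub p, sub_sub_cancel, mul_comm p, ← mul_assoc, ← MvPolynomial.C_mul,
        inv_mul_cancel₀ hq, MvPolynomial.C_1, one_mul] at h3
  exact key k le_rfl

/-- Elements of the powers of the maximal ideal as quotients of polynomials in the parameters. -/
theorem Spans.exists_mul_aeval_mem (hz : Spans z) (hx : x ∈ Z)
    (hsurj : ∀ φ : localRing Z x, ∃ F G : MvPolynomial (Fin n) ℂ, MvPolynomial.eval 0 G ≠ 0 ∧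
      φ * MvPolynomial.aeval z G = MvPolynomial.aeval z F) (k : ℕ) {φ : localRing Z x}
    (hφ : φ ∈ maxIdeal Z x ^ k) : ∃ F G : MvPolynomial (Fin n) ℂ, MvPolynomial.eval 0 G ≠ 0 ∧
      φ * MvPolynomial.aeval z G = MvPolynomial.aeval z F ∧
      F ∈ MvPolynomial.idealOfVars (Fin n) ℂ ^ k := by
  induction k generalizing φ with
  | zero =>
    obtain ⟨F, G, hG, h⟩ := hsurj φ
    exact ⟨F, G, hG, h, by simp⟩
  | succ k ih =>
    rw [pow_succ] at hφ
    refine Submodule.mul_induction_on hφ ?_ ?_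
    · intro a ha b hb
      obtain ⟨F, G, hG, h, hF⟩ := ih ha
      obtain ⟨F', G', hG', h'⟩ := hsurj b
      refine ⟨F * F', G * G', ?_, ?_, ?_⟩
      · rw [map_mul]
        exact mul_ne_zero hG hG'
      · rw [map_mul, map_mul, ← h, ← h']
        ring
      · rw [pow_succ]
        refine Ideal.mul_mem_mul hF ?_
        rw [mem_idealOfVars_iff, ← evalAt_aeval hz hx, ← h', map_mul, (mem_maxIdeal hx).1 hb,
          zero_mul]
    · rintro a b ⟨F, G, hG, h, hF⟩ ⟨F', G', hG', h', hF'⟩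
      refine ⟨F * G' + F' * G, G * G', ?_, ?_, ?_⟩
      · rw [map_mul]
        exact mul_ne_zero hG hG'
      · rw [map_add, map_mul, map_mul, map_mul, ← h, ← h']
        ring
      · exact add_mem (Ideal.mul_mem_right _ _ hF) (Ideal.mul_mem_right _ _ hF')

/-- A polynomial in algebraically independent parameters has the same order of vanishing as its
germ. Hence the class of a germ in `𝔪^k / 𝔪^(k+1)` determines its form of degree `k`. -/
theorem Spans.homogeneousComponent_eq_zero (hz : Spans z) (hx : x ∈ Z)
    (hsurj : ∀ φ : localRing Z x, ∃ F G : MvPolynomial (Fin n) ℂ, MvPolynomial.eval 0 G ≠ 0 ∧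
      φ * MvPolynomial.aeval z G = MvPolynomial.aeval z F)
    (hinj : Function.Injective (MvPolynomial.aeval z : MvPolynomial (Fin n) ℂ →ₐ[ℂ] localRing Z x))
    {k : ℕ} {Q : MvPolynomial (Fin n) ℂ}
    (hQ : MvPolynomial.aeval z Q ∈ maxIdeal Z x ^ (k + 1)) :
    MvPolynomial.homogeneousComponent k Q = 0 := by
  obtain ⟨F, G, hG, h, hF⟩ := hz.exists_mul_aeval_mem hx hsurj (k + 1) hQ
  rw [← map_mul] at h
  rw [← hinj h] at hF
  have hQ' := (MvPolynomial.mem_pow_idealOfVars_iff' _ _).1 (mem_pow_idealOfVars_of_mul hG hF)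
  refine MvPolynomial.homogeneousComponent_eq_zero' _ _ fun d hd he => ?_
  exact MvPolynomial.mem_support_iff.1 hd (hQ' d (by omega))

end Leading

/-! ### Fundamental forms of a graph -/

section Forms

variable {Z : Set (ℙ ℂ V)} {x : ℙ ℂ V} {ρ : ℂˣ →* LinearMap.GeneralLinearGroup ℂ V}
  {n m : ℕ} {b : Module.Basis (CoordIdx n m) ℂ (Module.Dual ℂ V)}
  {h : Fin m → MvPolynomial (Fin n) ℂ} {d : Fin m → ℕ}

/-- Polynomials in the coordinates `z_i` as elements of the symmetric algebra of the cotangent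
space. -/
def IsAdapted.symEquiv (hb : IsAdapted Z x ρ b) (hx : x ∈ Z) :
    MvPolynomial (Fin n) ℂ ≃ₐ[ℂ] SymmetricAlgebra ℂ (Cotangent Z x) :=
  (SymmetricAlgebra.equivMvPolynomial (hb.cotangentBasis hx)).symm

theorem IsAdapted.symEquiv_X (hb : IsAdapted Z x ρ b) (hx : x ∈ Z) (i : Fin n) :
    hb.symEquiv hx (MvPolynomial.X i) =
      SymmetricAlgebra.ι ℂ (Cotangent Z x) (hb.cotangentBasis hx i) :=
  SymmetricAlgebra.equivMvPolynomial_symm_X _ _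

/-- Cotangent vectors as linear forms in the coordinates `z_i`. -/
def IsAdapted.linearPart (hb : IsAdapted Z x ρ b) (hx : x ∈ Z) :
    Cotangent Z x →ₗ[ℂ] MvPolynomial (Fin n) ℂ :=
  (hb.cotangentBasis hx).constr ℂ MvPolynomial.X

theorem IsAdapted.linearPart_eq (hb : IsAdapted Z x ρ b) (hx : x ∈ Z) (a : Cotangent Z x) :
    hb.linearPart hx a =
      ∑ i, MvPolynomial.C ((hb.cotangentBasis hx).repr a i) * MvPolynomial.X i := by
  rw [linearPart, Module.Basis.constr_apply_fintype]
  simp [MvPolynomial.smul_eq_C_mul]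

theorem IsAdapted.linearPart_isHomogeneous (hb : IsAdapted Z x ρ b) (hx : x ∈ Z)
    (a : Cotangent Z x) : (hb.linearPart hx a).IsHomogeneous 1 := by
  rw [hb.linearPart_eq]
  exact MvPolynomial.IsHomogeneous.sum _ _ _ fun i _ => MvPolynomial.isHomogeneous_C_mul_X _ _

theorem IsAdapted.symEquiv_linearPart (hb : IsAdapted Z x ρ b) (hx : x ∈ Z) (a : Cotangent Z x) :
    hb.symEquiv hx (hb.linearPart hx a) = SymmetricAlgebra.ι ℂ (Cotangent Z x) a := by
  have e : (hb.symEquiv hx).toLinearMap ∘ₗ hb.linearPart hx =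
      SymmetricAlgebra.ι ℂ (Cotangent Z x) := by
    refine (hb.cotangentBasis hx).ext fun i => ?_
    rw [LinearMap.comp_apply, linearPart, Module.Basis.constr_basis]
    exact hb.symEquiv_X hx i
  exact congrArg (fun f => f a) e

theorem IsAdapted.sub_aeval_linearPart_mem (hb : IsAdapted Z x ρ b) (hx : x ∈ Z)
    (a : maxIdeal Z x) :
    (a : localRing Z x) -
      MvPolynomial.aeval hb.zGerm (hb.linearPart hx ((maxIdeal Z x).toCotangent a)) ∈
        maxIdeal Z x ^ 2 := by
  set c := (hb.cotangentBasis hx).repr ((maxIdeal Z x).toCotangent a)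
  have e : (maxIdeal Z x).toCotangent a = (maxIdeal Z x).toCotangent
      (∑ i, c i • (⟨hb.zGerm i, (hb.spans hx).mem i⟩ : maxIdeal Z x)) := by
    rw [map_sum]
    simp only [smul_toCotangent, ← hb.cotangentBasis_apply hx]
    exact ((hb.cotangentBasis hx).sum_repr _).symm
  rw [Ideal.toCotangent_eq] at e
  rw [hb.linearPart_eq]
  simpa [Algebra.smul_def] using e

theorem IsAdapted.evalSymm_eq (hb : IsAdapted Z x ρ b) (hx : x ∈ Z)
    (P : MvPolynomial (maxIdeal Z x) ℂ) : evalSymm Z x P = hb.symEquiv hx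
      (MvPolynomial.aeval (fun a => hb.linearPart hx ((maxIdeal Z x).toCotangent a)) P) := by
  have e : evalSymm Z x = (hb.symEquiv hx).toAlgHom.comp
      (MvPolynomial.aeval fun a => hb.linearPart hx ((maxIdeal Z x).toCotangent a)) := by
    refine MvPolynomial.algHom_ext fun a => ?_
    rw [evalSymm, MvPolynomial.aeval_X, AlgHom.comp_apply, MvPolynomial.aeval_X]
    exact (hb.symEquiv_linearPart hx _).symm
  rw [e]
  rfl

variable (hb : IsAdapted Z x ρ b) (hu : ∀ j, hb.uGerm j = MvPolynomial.aeval hb.zGerm (h j))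
  (hd : ∀ j, 2 ≤ d j ∧ (h j).IsHomogeneous (d j))

theorem evalAt_linearGerm_ne {t t' : Module.Dual ℂ V} (hx : x ∈ Z) (ht : t x.rep ≠ 0)
    (ht' : t' x.rep ≠ 0) : evalAt hx (linearGerm Z x t ht t') ≠ 0 := by
  rw [evalAt_linearGerm]
  exact div_ne_zero ht' ht

include hu hd in
theorem symEquiv_mem_leadingForms (hx : x ∈ Z) (j : Fin m) :
    hb.symEquiv hx (h j) ∈ leadingForms Z x (d j) := by
  set τ := linearGerm Z x (trivForm x) (trivForm_ne x) (b none)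
  set c := evalAt hx τ
  have hc : c ≠ 0 := evalAt_linearGerm_ne hx _ hb.chart
  have hmem : hb.uGerm j ∈ maxIdeal Z x ^ d j := by
    rw [hu]
    exact aeval_mem_pow (hb.spans hx).mem (hd j).2
  -- The factor `c` accounts for the change of trivialization: `u_j / l₀ = (u_j / t) τ ≡ c (u_j /
  -- t)` modulo `𝔪^(d_j + 1)`.
  let P : MvPolynomial (maxIdeal Z x) ℂ := MvPolynomial.C c *
    MvPolynomial.rename (fun i => ⟨hb.zGerm i, (hb.spans hx).mem i⟩) (h j)
  have hP : P.IsHomogeneous (d j) := (hd j).2.rename_isHomogeneous.C_mul c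
  have h1 : evalLocal Z x P = algebraMap ℂ _ c * hb.uGerm j := by
    simp only [evalLocal, P, map_mul, MvPolynomial.aeval_C, MvPolynomial.aeval_rename]
    rw [hu]
    rfl
  have h2 : evalSymm Z x P = c • hb.symEquiv hx (h j) := by
    rw [hb.evalSymm_eq hx]
    simp only [P, MvPolynomial.aeval_rename, ← MvPolynomial.smul_eq_C_mul, map_smul]
    congr 2
    have e : ((fun a => hb.linearPart hx ((maxIdeal Z x).toCotangent a)) ∘
        fun i => (⟨hb.zGerm i, (hb.spans hx).mem i⟩ : maxIdeal Z x)) = MvPolynomial.X := by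
      funext i
      rw [Function.comp_apply, ← hb.cotangentBasis_apply hx, IsAdapted.linearPart,
        Module.Basis.constr_basis]
    rw [e, MvPolynomial.aeval_X_left, AlgHom.id_apply]
  have h3 : c • hb.symEquiv hx (h j) ∈ leadingForms Z x (d j) := by
    refine Submodule.subset_span ⟨P, b (some (Sum.inr j)), hP, ?_, h2.symm⟩
    rw [← linearGerm_mul_linearGerm Z hb.chart, h1]
    change hb.uGerm j * τ - _ ∈ _
    rw [mul_comm (algebraMap _ _ _), ← mul_sub, pow_succ]
    exact Ideal.mul_mem_mul hmem (sub_algebraMap_mem_maxIdeal hx τ)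
  have h4 := Submodule.smul_mem _ c⁻¹ h3
  rwa [smul_smul, inv_mul_cancel₀ hc, one_smul] at h4

/-- `1`, the `z_i` and the `h_j` are all homogeneous, so a component of degree at least `2` of a
combination only collects those `h_j` that have this degree. -/
theorem homogeneousComponent_graphMap
    (hd : ∀ j, 2 ≤ d j ∧ (h j).IsHomogeneous (d j)) {k : ℕ} (hk : 2 ≤ k) (l : Module.Dual ℂ V) :
    MvPolynomial.homogeneousComponent k (graphMap b h l) ∈ LinearMap.range (graphMap b h) := by
  have hl : l ∈ Submodule.span ℂ (Set.range b) := by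
    rw [b.span_eq]
    exact Submodule.mem_top
  induction hl using Submodule.span_induction with
  | zero =>
    rw [map_zero, map_zero]
    exact zero_mem _
  | add l l' _ _ hl hl' =>
    rw [map_add, map_add]
    exact add_mem hl hl'
  | smul c l _ hl =>
    rw [map_smul, map_smul]
    exact Submodule.smul_mem _ c hl
  | mem l hl =>
    obtain ⟨i | i | j, rfl⟩ := hl
    · rw [graphMap_t, MvPolynomial.homogeneousComponent_of_mem
        (MvPolynomial.isHomogeneous_one (Fin n) ℂ), if_neg (by omega)]
      exact zero_mem _
    · rw [graphMap_z, MvPolynomial.homogeneousComponent_of_mem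
        (MvPolynomial.isHomogeneous_X ℂ i), if_neg (by omega)]
      exact zero_mem _
    · rw [graphMap_u, MvPolynomial.homogeneousComponent_of_mem (hd j).2]
      split_ifs
      · exact ⟨b (some (Sum.inr j)), graphMap_u j⟩
      · exact zero_mem _

include hu hd in
-- The leading term of `l / l₀` is, up to the constant `c`, the component of degree `k` of the
-- polynomial by which `l / t` is expressed in the `z_i / t`.
theorem leadingForms_le (hx : IsNonsingularAt Z x) {k : ℕ} (hk : 2 ≤ k) :
    leadingForms Z x k ≤
      LinearMap.range ((hb.symEquiv hx.1).toLinearMap ∘ₗ graphMap b h) := by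
  have := hx.2
  refine Submodule.span_le.2 ?_
  rintro _ ⟨P, l, hP, hl, rfl⟩
  rw [hb.evalSymm_eq hx.1]
  set L := fun a => hb.linearPart hx.1 ((maxIdeal Z x).toCotangent a)
  set p := MvPolynomial.aeval L P
  have hp : p.IsHomogeneous k := by
    have := hP.aeval L fun a => hb.linearPart_isHomogeneous hx.1 _
    rwa [one_mul] at this
  set τ := linearGerm Z x (trivForm x) (trivForm_ne x) (b none)
  set c := evalAt hx.1 τ
  have hc : c ≠ 0 := evalAt_linearGerm_ne hx.1 _ hb.chart
  have hτ : IsUnit τ := isUnit_of_evalAt_ne hx.1 hc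
  set F := graphMap b h l
  have h1 : evalLocal Z x P - MvPolynomial.aeval hb.zGerm p ∈ maxIdeal Z x ^ (k + 1) := by
    have := aeval_sub_aeval_mem_pow (I := maxIdeal Z x) (a := fun a : maxIdeal Z x => a.1)
      (b := fun a => MvPolynomial.aeval hb.zGerm (L a)) (fun a => a.2)
      (fun a => by
        rw [← pow_one (maxIdeal Z x)]
        exact aeval_mem_pow (hb.spans hx.1).mem
          (hb.linearPart_isHomogeneous hx.1 ((maxIdeal Z x).toCotangent a)))
      (fun a => hb.sub_aeval_linearPart_mem hx.1 a) hP
    rwa [← MvPolynomial.comp_aeval_apply] at this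
  have h2 := add_mem hl h1
  rw [sub_add_sub_cancel, ← linearGerm_mul_linearGerm Z hb.chart, linearGerm_eq_aeval hb hu] at h2
  change MvPolynomial.aeval hb.zGerm F * τ - _ ∈ _ at h2
  have hpk : MvPolynomial.aeval hb.zGerm p ∈ maxIdeal Z x ^ k :=
    aeval_mem_pow (hb.spans hx.1).mem hp
  -- Cancelling the unit `τ` puts `F(z)` in `𝔪^k`; replacing `τ` by its value `c` then costs only an
  -- element of `𝔪^(k+1)`.
  have h3 : MvPolynomial.aeval hb.zGerm F ∈ maxIdeal Z x ^ k := by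
    have := add_mem (Ideal.pow_le_pow_right k.le_succ h2) hpk
    rwa [sub_add_cancel, Ideal.mul_unit_mem_iff_mem _ hτ] at this
  have h4 : MvPolynomial.aeval hb.zGerm (MvPolynomial.C c * F - p) ∈ maxIdeal Z x ^ (k + 1) := by
    have h5 : MvPolynomial.aeval hb.zGerm F * (τ - algebraMap ℂ _ c) ∈ maxIdeal Z x ^ (k + 1) := by
      rw [pow_succ]
      exact Ideal.mul_mem_mul h3 (sub_algebraMap_mem_maxIdeal hx.1 τ)
    have h6 := sub_mem h2 h5
    rw [map_sub, map_mul, MvPolynomial.aeval_C]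
    convert h6 using 1
    ring
  have h7 := (hb.spans hx.1).homogeneousComponent_eq_zero hx.1 (exists_mul_aeval_eq hb hu hx.1)
    (hb.aeval_injective hu hx) h4
  rw [map_sub, MvPolynomial.homogeneousComponent_C_mul,
    MvPolynomial.homogeneousComponent_eq_self hp, sub_eq_zero] at h7
  obtain ⟨l', hl'⟩ := homogeneousComponent_graphMap (b := b) hd hk l
  refine ⟨c • l', ?_⟩
  rw [map_smul, LinearMap.comp_apply, hl', ← h7, ← MvPolynomial.smul_eq_C_mul, map_smul]
  rfl

include hu hd in
-- The form `t` accounts for degree `0`, the `z_i` for degree `1` and the `h_j` for the higher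
-- fundamental forms. The image of `V^*` is therefore intrinsic, although the embedding depends on
-- the coordinates.
theorem range_symEquiv_comp_graphMap (hx : IsNonsingularAt Z x) :
    LinearMap.range ((hb.symEquiv hx.1).toLinearMap ∘ₗ graphMap b h) =
      ⨆ k, fundamentalForms Z x k := by
  apply le_antisymm
  · rw [LinearMap.range_eq_map, ← b.span_eq, Submodule.map_span_le]
    rintro _ ⟨(_ | i | j), rfl⟩
    · refine Submodule.mem_iSup_of_mem 0 ?_
      change hb.symEquiv hx.1 (graphMap b h (b none)) ∈ (1 : Submodule ℂ _)
      rw [graphMap_t, map_one]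
      exact Submodule.one_le.1 le_rfl
    · refine Submodule.mem_iSup_of_mem 1 ?_
      change hb.symEquiv hx.1 (graphMap b h (b (some (Sum.inl i)))) ∈ LinearMap.range _
      rw [graphMap_z, hb.symEquiv_X]
      exact ⟨_, rfl⟩
    · obtain ⟨k, hk⟩ := Nat.exists_eq_add_of_le' (hd j).1
      refine Submodule.mem_iSup_of_mem (k + 2) ?_
      change hb.symEquiv hx.1 (graphMap b h (b (some (Sum.inr j)))) ∈ leadingForms Z x (k + 2)
      rw [graphMap_u, ← hk]
      exact symEquiv_mem_leadingForms hb hu hd hx.1 j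
  · refine iSup_le fun k => ?_
    match k with
    | 0 =>
      change (1 : Submodule ℂ _) ≤ _
      rw [Submodule.one_le]
      refine ⟨b none, ?_⟩
      rw [LinearMap.comp_apply, graphMap_t]
      exact map_one (hb.symEquiv hx.1)
    | 1 =>
      rintro _ ⟨a, rfl⟩
      rw [← (hb.cotangentBasis hx.1).sum_repr a, map_sum]
      refine sum_mem fun i _ => ?_
      rw [map_smul]
      refine Submodule.smul_mem _ _ ⟨b (some (Sum.inl i)), ?_⟩
      rw [LinearMap.comp_apply, graphMap_z]
      exact hb.symEquiv_X hx.1 i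
    | k + 2 => exact leadingForms_le hb hu hd hx (by omega)

/-- A nondegenerate variety with an action of Euler type at `x` is, in an affine chart, the set of
points whose coordinates are the values of the fundamental forms at `x` in a tangent vector. -/
theorem IsEulerType.exists_parametrization [FiniteDimensional ℂ V] (hρ : IsEulerType Z x ρ)
    (hZ : IsProjectiveVariety Z) (hn : IsNondegenerate Z) :
    ∃ (t : Module.Dual ℂ V) (E : Module.Dual ℂ V →ₗ[ℂ] SymmetricAlgebra ℂ (Cotangent Z x)),
      t x.rep ≠ 0 ∧ E t = 1 ∧ Function.Injective E ∧
      LinearMap.range E = ⨆ k, fundamentalForms Z x k ∧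
      ∀ y : ℙ ℂ V, t y.rep ≠ 0 → (y ∈ Z ↔
        ∃ ev : SymmetricAlgebra ℂ (Cotangent Z x) →ₐ[ℂ] ℂ, ∀ l, l y.rep = t y.rep * ev (E l)) := by
  obtain ⟨n, m, b, hb⟩ := hρ.exists_isAdapted
  choose d h hd hh hu using hb.exists_uGerm_eq hρ hZ hn
  have hx := hρ.nonsingular
  refine ⟨b none, (hb.symEquiv hx.1).toLinearMap ∘ₗ graphMap b h, hb.chart, ?_, ?_,
    range_symEquiv_comp_graphMap hb hu (fun j => ⟨hd j, hh j⟩) hx, fun y hy => ⟨fun hyZ => ?_, ?_⟩⟩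
  · rw [LinearMap.comp_apply, graphMap_t]
    exact map_one (hb.symEquiv hx.1)
  · exact (hb.symEquiv hx.1).injective.comp (graphMap_injective hb hu hZ hx.1 hn)
  · have hg := graph_of_mem hb hu hZ hx.1 (fun j => ⟨one_le_two.trans (hd j), hh j⟩) hy hyZ
    -- A tangent vector is encoded by evaluation of polynomials at it; here its coordinates are the
    -- `z_i / t` at `y`.
    refine ⟨(MvPolynomial.aeval fun i => b (some (Sum.inl i)) y.rep / b none y.rep).comp
      (hb.symEquiv hx.1).symm.toAlgHom, fun l => ?_⟩
    have e := eval_graphMap hy hg l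
    rw [← MvPolynomial.aeval_eq_eval] at e
    have e' : ((MvPolynomial.aeval fun i => b (some (Sum.inl i)) y.rep / b none y.rep).comp
        (hb.symEquiv hx.1).symm.toAlgHom) (hb.symEquiv hx.1 (graphMap b h l)) =
        l y.rep / b none y.rep := by
      rw [← e, AlgHom.comp_apply]
      congr 1
      exact (hb.symEquiv hx.1).symm_apply_apply _
    rw [mul_comm]
    exact (div_eq_iff hy).1 e'.symm
  · rintro ⟨ev, hev⟩
    refine mem_of_graph hb hu hZ hx hy fun j => ?_
    have h1 : ∀ l, l y.rep / b none y.rep = ev (hb.symEquiv hx.1 (graphMap b h l)) := fun l => by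
      rw [hev l, mul_div_cancel_left₀ _ hy]
      rfl
    simp only [h1, graphMap_u, graphMap_z]
    have h2 : ev.comp (hb.symEquiv hx.1).toAlgHom =
        MvPolynomial.aeval fun i => ev (hb.symEquiv hx.1 (MvPolynomial.X i)) :=
      MvPolynomial.algHom_ext fun i => by
        rw [MvPolynomial.aeval_X]
        rfl
    exact congrArg (fun f => f (h j)) h2

end Forms

/-! ### Projective equivalence -/

section Equivalence

/-- The isomorphism of symmetric algebras induced by a linear isomorphism. -/
def symMapEquiv {M N : Type*} [AddCommGroup M] [Module ℂ M] [AddCommGroup N] [Module ℂ N]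
    (φ : M ≃ₗ[ℂ] N) : SymmetricAlgebra ℂ M ≃ₐ[ℂ] SymmetricAlgebra ℂ N :=
  AlgEquiv.ofAlgHom (symMap φ.toLinearMap) (symMap φ.symm.toLinearMap)
    (SymmetricAlgebra.algHom_ext (LinearMap.ext fun a => by simp [symMap]))
    (SymmetricAlgebra.algHom_ext (LinearMap.ext fun a => by simp [symMap]))

/-- Two injective linear maps whose ranges correspond under an isomorphism differ by an
automorphism of the domain. -/
theorem exists_linearEquiv_of_range_eq {W M N : Type*} [AddCommGroup W] [Module ℂ W]
    [AddCommGroup M] [Module ℂ M] [AddCommGroup N] [Module ℂ N] {E₁ : W →ₗ[ℂ] M} {E₂ : W →ₗ[ℂ] N}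
    (h₁ : Function.Injective E₁) (h₂ : Function.Injective E₂) (Φ : M ≃ₗ[ℂ] N)
    (h : (LinearMap.range E₁).map Φ.toLinearMap = LinearMap.range E₂) :
    ∃ G : W ≃ₗ[ℂ] W, ∀ l, E₂ (G l) = Φ (E₁ l) := by
  let e : LinearMap.range E₁ ≃ₗ[ℂ] LinearMap.range E₂ :=
    Φ.submoduleMap _ ≪≫ₗ LinearEquiv.ofEq _ _ h
  refine ⟨LinearEquiv.ofInjective E₁ h₁ ≪≫ₗ e ≪≫ₗ (LinearEquiv.ofInjective E₂ h₂).symm,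
    fun l => ?_⟩
  have h3 := (LinearEquiv.ofInjective E₂ h₂).apply_symm_apply (e (LinearEquiv.ofInjective E₁ h₁ l))
  exact congrArg Subtype.val h3

/-- Every automorphism of the dual space comes from an automorphism of the space. -/
theorem exists_dual_apply [FiniteDimensional ℂ V] (G : Module.Dual ℂ V ≃ₗ[ℂ] Module.Dual ℂ V) :
    ∃ g : LinearMap.GeneralLinearGroup ℂ V, ∀ l v, G l ((g : V →ₗ[ℂ] V) v) = l v := by
  -- The inverse transpose of `G`, carried to `V` by biduality.
  let g : V ≃ₗ[ℂ] V := Module.evalEquiv ℂ V ≪≫ₗ G.symm.dualMap ≪≫ₗ (Module.evalEquiv ℂ V).symm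
  refine ⟨LinearMap.GeneralLinearGroup.ofLinearEquiv g, fun l v => ?_⟩
  have h : Module.evalEquiv ℂ V (g v) = G.symm.dualMap (Module.evalEquiv ℂ V v) :=
    (Module.evalEquiv ℂ V).apply_symm_apply _
  have h1 := congrArg (fun f => f (G l)) h
  simp only [Module.evalEquiv_apply, Module.Dual.eval_apply, LinearEquiv.dualMap_apply,
    LinearEquiv.symm_apply_apply] at h1
  exact h1

/-- By irreducibility each variety is the closure of its part in the chart, and `g` and `g⁻¹` are
Zariski continuous. -/
theorem projectivelyEquivalent_of_chart {Z₁ Z₂ : Set (ℙ ℂ V)} {x₁ x₂ : ℙ ℂ V}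
    (hZ₁ : IsProjectiveVariety Z₁) (hZ₂ : IsProjectiveVariety Z₂) (hx₁ : x₁ ∈ Z₁) (hx₂ : x₂ ∈ Z₂)
    {t₁ t₂ : Module.Dual ℂ V} (ht₁ : t₁ x₁.rep ≠ 0) (ht₂ : t₂ x₂.rep ≠ 0)
    {g : LinearMap.GeneralLinearGroup ℂ V} (hgt : ∀ v, t₂ ((g : V →ₗ[ℂ] V) v) = t₁ v)
    (hg : ∀ y : ℙ ℂ V, t₁ y.rep ≠ 0 → (y ∈ Z₁ ↔ g • y ∈ Z₂)) : ProjectivelyEquivalent Z₁ Z₂ := by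
  have hclosed : ∀ (g : LinearMap.GeneralLinearGroup ℂ V) {Z : Set (ℙ ℂ V)},
      IsProjectiveVariety Z → IsClosed[zariski V] ((fun y : ℙ ℂ V => g • y) ⁻¹' Z) := by
    intro g Z hZ
    let _ := zariski V
    exact hZ.1.preimage (continuous_smul_zariski g)
  refine ⟨g, Set.Subset.antisymm ?_ fun y hy => ?_⟩
  · rw [Set.image_subset_iff]
    exact subset_of_isClosed hZ₁ hx₁ ht₁ (hclosed g hZ₂) fun y hy hty => (hg y hty).1 hy
  · refine ⟨g⁻¹ • y, ?_, smul_inv_smul g y⟩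
    refine subset_of_isClosed hZ₂ hx₂ ht₂ (hclosed g⁻¹ hZ₁) (fun y hy hty => ?_) hy
    refine (hg _ fun h0 => hty ?_).2 (by rwa [smul_inv_smul])
    obtain ⟨a, ha⟩ := smul_rep g (g⁻¹ • y)
    rw [smul_inv_smul] at ha
    rw [ha, map_smul, hgt, h0, smul_zero]

theorem projectivelyEquivalent_of_fundamentalFormsIso [FiniteDimensional ℂ V]
    {Z₁ Z₂ : Set (ℙ ℂ V)} {x₁ x₂ : ℙ ℂ V} (hZ₁ : IsProjectiveVariety Z₁)
    (hZ₂ : IsProjectiveVariety Z₂) (hn₁ : IsNondegenerate Z₁) (hn₂ : IsNondegenerate Z₂)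
    (h₁ : HasEulerAction Z₁ x₁) (h₂ : HasEulerAction Z₂ x₂)
    (h : FundamentalFormsIso Z₁ x₁ Z₂ x₂) : ProjectivelyEquivalent Z₁ Z₂ := by
  obtain ⟨ρ₁, h₁⟩ := h₁
  obtain ⟨ρ₂, h₂⟩ := h₂
  obtain ⟨φ, hφ⟩ := h
  obtain ⟨t₁, E₁, ht₁, hEt₁, hE₁, hr₁, hy₁⟩ := h₁.exists_parametrization hZ₁ hn₁
  obtain ⟨t₂, E₂, ht₂, hEt₂, hE₂, hr₂, hy₂⟩ := h₂.exists_parametrization hZ₂ hn₂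
  obtain ⟨G, hG⟩ := exists_linearEquiv_of_range_eq hE₁ hE₂ (symMapEquiv φ).toLinearEquiv (by
    rw [hr₁, hr₂, Submodule.map_iSup]
    exact iSup_congr hφ)
  obtain ⟨g, hg⟩ := exists_dual_apply G
  -- An algebra isomorphism preserves `1`, so the affine charts correspond.
  have hGt : G t₁ = t₂ := hE₂ <| by
    rw [hG, hEt₁, hEt₂]
    exact map_one (symMapEquiv φ)
  refine projectivelyEquivalent_of_chart hZ₁ hZ₂ h₁.nonsingular.1 h₂.nonsingular.1 ht₁ ht₂ (g := g)
    (fun v => by rw [← hGt, hg]) fun y hty => ?_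
  obtain ⟨a, ha⟩ := smul_rep g y
  have hl : ∀ l, G l (g • y).rep = a * l y.rep := fun l => by
    rw [ha, map_smul, hg, smul_eq_mul]
  have ht : t₂ (g • y).rep = a * t₁ y.rep := by rw [← hGt, hl]
  rw [hy₁ y hty, hy₂ _ (by rw [ht]; exact mul_ne_zero a.ne_zero hty)]
  -- Tangent vectors, as algebra homomorphisms to `ℂ`, are transported by composition with the
  -- isomorphism of symmetric algebras.
  constructor
  · rintro ⟨ev, hev⟩
    refine ⟨ev.comp (symMapEquiv φ).symm.toAlgHom, fun l => ?_⟩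
    obtain ⟨l, rfl⟩ := G.surjective l
    have e : (symMapEquiv φ).symm (E₂ (G l)) = E₁ l := by
      rw [hG]
      exact (symMapEquiv φ).symm_apply_apply _
    rw [hl, ht, hev l, mul_assoc, ← e]
    rfl
  · rintro ⟨ev, hev⟩
    refine ⟨ev.comp (symMapEquiv φ).toAlgHom, fun l => ?_⟩
    have e := hev (G l)
    rw [hl, ht, mul_assoc, hG] at e
    exact mul_left_cancel₀ a.ne_zero e

end Equivalence

end

end EulerSymm

theorem propositionp {V : Type*} [AddCommGroup V] [Module ℂ V] [FiniteDimensional ℂ V] :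
    (∀ Z₁ Z₂ : Set (ℙ ℂ V), EulerSymm.IsEulerSymmetric Z₁ → EulerSymm.IsEulerSymmetric Z₂ →
      EulerSymm.zariskiDim Z₁ = EulerSymm.zariskiDim Z₂ →
      ∀ x₁ x₂ : ℙ ℂ V, EulerSymm.HasEulerAction Z₁ x₁ → EulerSymm.HasEulerAction Z₂ x₂ →
        EulerSymm.FundamentalFormsIso Z₁ x₁ Z₂ x₂ → EulerSymm.ProjectivelyEquivalent Z₁ Z₂) ∧
    (∀ Z : Set (ℙ ℂ V), EulerSymm.IsProjectiveVariety Z → EulerSymm.IsNondegenerate Z →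
      ∀ (x : ℙ ℂ V) (ρ : ℂˣ →* LinearMap.GeneralLinearGroup ℂ V), EulerSymm.IsEulerType Z x ρ →
        (∃ (n m : ℕ) (b : Module.Basis (EulerSymm.CoordIdx n m) ℂ (Module.Dual ℂ V)),
          EulerSymm.IsAdapted Z x ρ b) ∧
        ∀ (n m : ℕ) (b : Module.Basis (EulerSymm.CoordIdx n m) ℂ (Module.Dual ℂ V)),
          EulerSymm.IsAdapted Z x ρ b → EulerSymm.IsHomogeneousGraph Z b) :=
  ⟨fun _ _ h₁ h₂ _ _ _ e₁ e₂ h =>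
    EulerSymm.projectivelyEquivalent_of_fundamentalFormsIso h₁.variety h₂.variety h₁.nondegenerate
      h₂.nondegenerate e₁ e₂ h,
    fun _ hZ hn _ _ h => ⟨h.exists_isAdapted, fun _ _ _ hb => hb.isHomogeneousGraph h hZ hn⟩⟩
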